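/- For an integer $m\ge 6$ let $$X=\{(z_1,z_2)\in\mathbb C^2: |z_1|>e,\ |z_2|<\tfrac{1}{|z_1|\log|z_1|}\},\quad Y_m=\{(z_1,z_2)\in\mathbb C^2: |z_2|>2,\ \bigl||z_1|-\tfrac1{|z_2|}\bigr|<\tfrac1{|z_2|^m}\},$$ $$Z=\{(z_1,z_2)\in\mathbb C^2: |z_1|\le e,\ |z_2|\le 2\},$$ and let $\Omega_m$ be the interior of $X\cup Y_m\cup Z$. Let $A^2(\Omega_m)$ be the Bergman space, i.e. the closed subspace of $L^2(\Omega_m)$ (Lebesgue measure $dV$) consisting of the square integrable holomorphic functions on $\Omega_m$, let $\mathcal B$ be the orthogonal projection of $L^2(\Omega_m)$ onto $A^2(\Omega_m)$, and let $T_\phi:A^2(\Omega_m)\to A^2(\Omega_m)$, $T_\phi f=\mathcal B(\phi f)$, be the Toeplitz operator with symbol $\phi(z)=z_1/\bar z_1$. Put $$R_m=\Bigl\{(\alpha_1,\alpha_2)\in\mathbb N^2:\ \alpha_2\ge\alpha_1>\alpha_2-\tfrac{m-1}{2}\Bigr\},\qquad c_\alpha^2=\int_{\Omega_m}|z_1^{\alpha_1}z_2^{\alpha_2}|^2\,dV,$$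 where $\mathbb N=\{0,1,2,\dots\}$. Then: (i) $T_\phi$ is not the zero operator. (ii) $T_\phi$ does not have finite rank. (iii) $T_\phi$ is a bounded operator. (iv) $T_\phi$ is nilpotent of degree $N=\lfloor\frac{m+2}{4}\rfloor$, that is, $T_\phi^{N}=0$ and $T_\phi^{k}\ne 0$ for all $0\le k<N$. (v) For $\alpha\in\mathbb N^2$, the monomial $z^\alpha=z_1^{\alpha_1}z_2^{\alpha_2}$ belongs to $A^2(\Omega_m)$ if and only if $\alpha\in R_m$. For $\alpha\in R_m$, $$T_\phi(z^\alpha)=\frac{c_{(\alpha_1+1,\alpha_2)}^2}{c_{(\alpha_1+2,\alpha_2)}^2}\,z_1^{\alpha_1+2}z_2^{\alpha_2}\ \text{ if }(\alpha_1+2,\alpha_2)\in R_m,\qquad T_\phi(z^\alpha)=0\ \text{ otherwise.}$$ -/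

import Mathlib

open MeasureTheory Filter Topology Metric
open scoped ENNReal ComplexConjugate

theorem circle_submean {g : ℂ × ℂ → ℂ} {z w : ℂ × ℂ} {R : ℝ}
    (hg : DifferentiableOn ℂ g (ball z R)) (hw : w ∈ ball (0 : ℂ × ℂ) R) :
    ENNReal.ofReal (2 * Real.pi) * ‖g z‖ₑ ^ 2 ≤
      ∫⁻ θ in Set.Ioc 0 (2 * Real.pi),
        (ball z R).indicator (fun x => ‖g x‖ₑ ^ 2) (z + circleMap 0 1 θ • w) := by
  have hmem : ∀ c : ℂ, c ∈ closedBall (0 : ℂ) 1 → z + c • w ∈ ball z R := by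
    intro c hc
    rw [mem_ball_zero_iff] at hw
    rw [mem_closedBall_zero_iff] at hc
    rw [mem_ball_iff_norm, add_sub_cancel_left, norm_smul]
    nlinarith [norm_nonneg w, norm_nonneg c]
  have hd : DiffContOnCl ℂ (fun c : ℂ => g (z + c • w) ^ 2) (ball 0 |1|) := by
    have hdiff : DifferentiableOn ℂ (fun c : ℂ => g (z + c • w) ^ 2) (closedBall 0 1) := by
      refine DifferentiableOn.pow (hg.comp (f := fun c : ℂ => z + c • w) ?_ hmem) 2
      fun_prop
    rw [abs_one]
    exact DifferentiableOn.diffContOnCl (by rwa [closure_ball _ one_ne_zero])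
  have hav := hd.circleAverage
  rw [Real.circleAverage_def, zero_smul, add_zero,
    intervalIntegral.integral_of_le Real.two_pi_pos.le,
    inv_smul_eq_iff₀ Real.two_pi_pos.ne'] at hav
  have h1 := enorm_integral_le_lintegral_enorm (μ := volume.restrict (Set.Ioc 0 (2 * Real.pi)))
    (fun θ => g (z + circleMap 0 1 θ • w) ^ 2)
  rw [hav, enorm_smul, enorm_pow, Real.enorm_eq_ofReal Real.two_pi_pos.le] at h1
  refine h1.trans_eq (lintegral_congr fun θ => ?_)
  rw [Set.indicator_of_mem (hmem _ ?_), enorm_pow]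
  simp

theorem measurePreserving_unit_smul (c : ℂ) (hc : ‖c‖ = 1) :
    MeasurePreserving (fun w : ℂ × ℂ => c • w) volume volume := by
  have h : MeasurePreserving (fun w : ℂ => c * w) volume volume :=
    (rotation ⟨c, by simpa [Submonoid.unitSphere] using hc⟩).measurePreserving
  exact h.prod h

theorem isAddHaarMeasure_volume : (volume : Measure (ℂ × ℂ)).IsAddHaarMeasure :=
  inferInstanceAs ((volume : Measure ℂ).prod (volume : Measure ℂ)).IsAddHaarMeasure

theorem ball_submean {g : ℂ × ℂ → ℂ} {z : ℂ × ℂ} {R : ℝ} 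
    (hg : DifferentiableOn ℂ g (ball z R)) :
    volume (ball z R) * ‖g z‖ₑ ^ 2 ≤ ∫⁻ x in ball z R, ‖g x‖ₑ ^ 2 := by
  have := isAddHaarMeasure_volume
  set F : ℂ × ℂ → ℝ≥0∞ := (ball z R).indicator (fun x => ‖g x‖ₑ ^ 2) with hF
  have hFm : Measurable F := by
    classical
    have := ((ENNReal.continuous_pow 2).comp_continuousOn hg.continuousOn.enorm).measurable_piecewise
      (continuousOn_const (c := (0 : ℝ≥0∞)) (s := (ball z R)ᶜ)) isOpen_ball.measurableSet
    convert this using 1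
    exact (Set.piecewise_eq_indicator).symm
  have hrot : ∀ θ : ℝ, ∫⁻ w in ball (0 : ℂ × ℂ) R, F (z + circleMap 0 1 θ • w) =
      ∫⁻ w in ball (0 : ℂ × ℂ) R, F (z + w) := by
    intro θ
    have hc : ‖circleMap 0 1 θ‖ = 1 := by simp
    have := (measurePreserving_unit_smul _ hc).setLIntegral_comp_preimage (s := ball (0 : ℂ × ℂ) R)
      isOpen_ball.measurableSet (f := fun w => F (z + w)) (by fun_prop)
    rw [← this]
    congr 2
    ext w
    simp [norm_smul]
  have htr : ∫⁻ w in ball (0 : ℂ × ℂ) R, F (z + w) = ∫⁻ x in ball z R, ‖g x‖ₑ ^ 2 := by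
    have := (measurePreserving_add_left (volume : Measure (ℂ × ℂ)) z).setLIntegral_comp_preimage
      (s := ball z R) isOpen_ball.measurableSet hFm
    rw [preimage_add_ball, sub_self] at this
    rw [this]
    exact setLIntegral_congr_fun isOpen_ball.measurableSet
      fun x hx => Set.indicator_of_mem hx _
  have hpi : ENNReal.ofReal (2 * Real.pi) ≠ 0 := by simp [Real.pi_pos]
  have key : ENNReal.ofReal (2 * Real.pi) * (volume (ball z R) * ‖g z‖ₑ ^ 2) ≤
      ENNReal.ofReal (2 * Real.pi) * ∫⁻ x in ball z R, ‖g x‖ₑ ^ 2 := by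
    calc _ = ∫⁻ _ in ball (0 : ℂ × ℂ) R, ENNReal.ofReal (2 * Real.pi) * ‖g z‖ₑ ^ 2 := by
          rw [setLIntegral_const, Measure.addHaar_ball_center volume z]; ring
      _ ≤ ∫⁻ w in ball (0 : ℂ × ℂ) R, ∫⁻ θ in Set.Ioc 0 (2 * Real.pi),
            F (z + circleMap 0 1 θ • w) :=
          setLIntegral_mono' isOpen_ball.measurableSet fun w hw => circle_submean hg hw
      _ = ∫⁻ θ in Set.Ioc 0 (2 * Real.pi), ∫⁻ w in ball (0 : ℂ × ℂ) R,
            F (z + circleMap 0 1 θ • w) := by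
          apply lintegral_lintegral_swap
          apply Measurable.aemeasurable
          have : Continuous fun p : (ℂ × ℂ) × ℝ => z + circleMap 0 1 p.2 • p.1 := by
            have := continuous_circleMap 0 1
            fun_prop
          exact hFm.comp this.measurable
      _ = _ := by
          simp_rw [hrot, htr]
          rw [setLIntegral_const]; simp [mul_comm]
  exact (ENNReal.mul_le_mul_iff_right hpi ENNReal.ofReal_ne_top).1 key

open TopologicalSpace in
/-- The Bergman space `A²(Ω)`, as a subspace of `L²(Ω)`: the classes that have a holomorphic
representative on `Ω`. -/
def bergmanSpace (Ω : Opens (ℂ × ℂ)) :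
    Submodule ℂ (Lp ℂ 2 (volume.restrict (Ω : Set (ℂ × ℂ)))) where
  carrier := {f | ∃ g : ℂ × ℂ → ℂ, DifferentiableOn ℂ g Ω ∧
    f =ᵐ[volume.restrict (Ω : Set (ℂ × ℂ))] g}
  zero_mem' := ⟨0, differentiableOn_const 0, Lp.coeFn_zero _ _ _⟩
  add_mem' := by
    rintro a b ⟨g, hg, hag⟩ ⟨h, hh, hbh⟩
    exact ⟨g + h, hg.add hh, (Lp.coeFn_add a b).trans (hag.add hbh)⟩
  smul_mem' := by
    rintro c a ⟨g, hg, hag⟩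
    exact ⟨c • g, hg.const_smul c, (Lp.coeFn_smul c a).trans (hag.const_smul c)⟩

open TopologicalSpace in
theorem bergmanSpace_point_bound (Ω : Opens (ℂ × ℂ))
    {a b : Lp ℂ 2 (volume.restrict (Ω : Set (ℂ × ℂ)))} {g h : ℂ × ℂ → ℂ}
    (hg : DifferentiableOn ℂ g Ω) (hag : a =ᵐ[volume.restrict (Ω : Set (ℂ × ℂ))] g)
    (hh : DifferentiableOn ℂ h Ω) (hbh : b =ᵐ[volume.restrict (Ω : Set (ℂ × ℂ))] h)
    {z : ℂ × ℂ} {R : ℝ} (hR : 0 < R) (hz : ball z R ⊆ Ω) :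
    ‖g z - h z‖ ≤ (Real.sqrt (volume.real (ball (0 : ℂ × ℂ) R)))⁻¹ * dist a b := by
  have := isAddHaarMeasure_volume
  have hv : 0 < volume.real (ball (0 : ℂ × ℂ) R) :=
    ENNReal.toReal_pos (measure_ball_pos _ _ hR).ne' measure_ball_lt_top.ne
  have h1 := ball_submean ((hg.sub hh).mono hz)
  have h2 : ∫⁻ x in ball z R, ‖(g - h) x‖ₑ ^ 2 ≤ ENNReal.ofReal (dist a b) ^ 2 := by
    calc _ ≤ ∫⁻ x in Ω, ‖(g - h) x‖ₑ ^ 2 := lintegral_mono_set hz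
      _ = ∫⁻ x in Ω, ‖(a - b : Lp ℂ 2 (volume.restrict (Ω : Set (ℂ × ℂ)))) x‖ₑ ^ 2 := by
          apply lintegral_congr_ae
          filter_upwards [hag, hbh, Lp.coeFn_sub a b] with x hx1 hx2 hx3
          rw [hx3, Pi.sub_apply, Pi.sub_apply, hx1, hx2]
      _ = ENNReal.ofReal (dist a b) ^ 2 := by
          rw [dist_eq_norm, ofReal_norm, Lp.enorm_def,
            eLpNorm_eq_lintegral_rpow_enorm_toReal (by simp) (by simp)]
          simp only [ENNReal.toReal_ofNat, ENNReal.rpow_ofNat]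
          rw [← ENNReal.rpow_natCast, ← ENNReal.rpow_mul]
          norm_num
  have h3 := ENNReal.toReal_mono (by simp) (h1.trans h2)
  rw [Measure.addHaar_ball_center] at h3
  simp only [ENNReal.toReal_mul, ENNReal.toReal_pow, toReal_enorm, Pi.sub_apply,
    ENNReal.toReal_ofReal dist_nonneg] at h3
  change volume.real (ball (0 : ℂ × ℂ) R) * _ ≤ _ at h3
  have h4 : Real.sqrt (volume.real (ball (0 : ℂ × ℂ) R)) * ‖g z - h z‖ ≤ dist a b := by
    refine abs_le_of_sq_le_sq' ?_ dist_nonneg |>.2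
    rwa [mul_pow, Real.sq_sqrt hv.le]
  rw [inv_mul_eq_div, le_div_iff₀ (Real.sqrt_pos.2 hv), mul_comm]
  exact h4

open TopologicalSpace in
theorem isClosed_bergmanSpace (Ω : Opens (ℂ × ℂ)) :
    IsClosed (bergmanSpace Ω : Set (Lp ℂ 2 (volume.restrict (Ω : Set (ℂ × ℂ))))) := by
  apply IsSeqClosed.isClosed
  intro u f hu hf
  choose g hg hug using hu
  have hloc : ∀ x ∈ (Ω : Set (ℂ × ℂ)), ∃ R > 0, ∃ C : ℝ, ball x R ⊆ Ω ∧
      ∀ y ∈ ball x R, ∀ n m, ‖g n y - g m y‖ ≤ C * dist (u n) (u m) ∧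
        ‖fderiv ℂ (g n) y - fderiv ℂ (g m) y‖ ≤ C * dist (u n) (u m) := by
    intro x hx
    obtain ⟨ε, hε, hεΩ⟩ := Metric.isOpen_iff.1 Ω.isOpen x hx
    set R := ε / 3
    have hR : 0 < R := by positivity
    set D : ℝ := (Real.sqrt (volume.real (ball (0 : ℂ × ℂ) R)))⁻¹
    have hD : 0 ≤ D := by positivity
    have hb : ∀ y ∈ ball x (2 * R), ∀ n m, ‖g n y - g m y‖ ≤ D * dist (u n) (u m) := by
      intro y hy n m
      refine bergmanSpace_point_bound Ω (hg n) (hug n) (hg m) (hug m) hR ?_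
      refine (ball_subset_ball' ?_).trans hεΩ
      rw [mem_ball] at hy
      have : ε = 3 * R := by simp only [R]; ring
      linarith
    have hsub : ball x R ⊆ (Ω : Set (ℂ × ℂ)) :=
      (ball_subset_ball (by simp only [R]; linarith)).trans hεΩ
    refine ⟨R, hR, D + 2 * D / R, hsub, fun y hy n m => ⟨?_, ?_⟩⟩
    · refine (hb y (ball_subset_ball (by linarith) hy) n m).trans ?_
      gcongr
      have : 0 ≤ 2 * D / R := by positivity
      linarith
    · have hyR : ball y R ⊆ ball x (2 * R) := ball_subset_ball' (by
        rw [mem_ball] at hy; linarith)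
      have h2RΩ : ball x (2 * R) ⊆ (Ω : Set (ℂ × ℂ)) :=
        (ball_subset_ball (by simp only [R]; linarith)).trans hεΩ
      have hdn : ∀ k, DifferentiableAt ℂ (g k) y := fun k =>
        (hg k).differentiableAt (Ω.isOpen.mem_nhds (hsub hy))
      rw [← fderiv_sub (hdn n) (hdn m)]
      have hmaps : Set.MapsTo (g n - g m) (ball y R)
          (closedBall ((g n - g m) y) (2 * D * dist (u n) (u m))) := by
        intro w hw
        rw [mem_closedBall, dist_eq_norm]
        refine (norm_sub_le _ _).trans ?_
        have h1 := hb w (hyR hw) n m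
        have h2 := hb y (hyR (mem_ball_self hR)) n m
        simp only [Pi.sub_apply]
        linarith
      refine (Complex.norm_fderiv_le_div_of_mapsTo_ball
        (((hg n).sub (hg m)).mono (hyR.trans h2RΩ)) hmaps hR).trans ?_
      have : 0 ≤ D * dist (u n) (u m) := by positivity
      calc _ = 2 * D / R * dist (u n) (u m) := by ring
        _ ≤ _ := by linarith
  have hcs := hf.cauchySeq
  have hsmall : ∀ C : ℝ, ∀ ε > 0, ∃ N, ∀ m ≥ N, ∀ n ≥ N, C * dist (u m) (u n) < ε := by
    intro C ε hε
    obtain ⟨N, hN⟩ := Metric.cauchySeq_iff.1 hcs (ε / (|C| + 1)) (by positivity)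
    refine ⟨N, fun m hm n hn => ?_⟩
    have := hN m hm n hn
    rw [lt_div_iff₀ (by positivity)] at this
    nlinarith [le_abs_self C, dist_nonneg (x := u m) (y := u n)]
  have hlim : ∀ y ∈ (Ω : Set (ℂ × ℂ)), Tendsto (fun n => g n y) atTop
      (𝓝 (limUnder atTop fun n => g n y)) := by
    intro y hy
    obtain ⟨R, hR, C, -, hC⟩ := hloc y hy
    refine CauchySeq.tendsto_limUnder (Metric.cauchySeq_iff.2 fun ε hε => ?_)
    obtain ⟨N, hN⟩ := hsmall C ε hε
    exact ⟨N, fun m hm n hn => by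
      rw [dist_eq_norm]; exact (hC y (mem_ball_self hR) m n).1.trans_lt (hN m hm n hn)⟩
  have hlim' : ∀ y ∈ (Ω : Set (ℂ × ℂ)), Tendsto (fun n => fderiv ℂ (g n) y) atTop
      (𝓝 (limUnder atTop fun n => fderiv ℂ (g n) y)) := by
    intro y hy
    obtain ⟨R, hR, C, -, hC⟩ := hloc y hy
    refine CauchySeq.tendsto_limUnder (Metric.cauchySeq_iff.2 fun ε hε => ?_)
    obtain ⟨N, hN⟩ := hsmall C ε hε
    exact ⟨N, fun m hm n hn => by
      rw [dist_eq_norm]; exact (hC y (mem_ball_self hR) m n).2.trans_lt (hN m hm n hn)⟩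
  refine ⟨fun y => limUnder atTop fun n => g n y, ?_, ?_⟩
  · intro x hx
    obtain ⟨R, hR, C, hsub, hC⟩ := hloc x hx
    have hunif : TendstoUniformlyOn (fun n => fderiv ℂ (g n))
        (fun y => limUnder atTop fun n => fderiv ℂ (g n) y) atTop (ball x R) := by
      refine UniformCauchySeqOn.tendstoUniformlyOn_of_tendsto ?_ fun y hy => hlim' y (hsub hy)
      refine Metric.uniformCauchySeqOn_iff.2 fun ε hε => ?_
      obtain ⟨N, hN⟩ := hsmall C ε hε
      exact ⟨N, fun m hm n hn y hy => by
        rw [dist_eq_norm]; exact (hC y hy m n).2.trans_lt (hN m hm n hn)⟩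
    have := hasFDerivAt_of_tendstoUniformlyOn isOpen_ball hunif
      (fun n y hy => ((hg n).differentiableAt (Ω.isOpen.mem_nhds (hsub hy))).hasFDerivAt)
      (fun y hy => hlim y (hsub hy)) (mem_ball_self hR)
    exact this.differentiableAt.differentiableWithinAt
  · obtain ⟨ns, hns, hae⟩ := (tendstoInMeasure_of_tendsto_Lp hf).exists_seq_tendsto_ae
    filter_upwards [hae, ae_all_iff.2 hug, ae_restrict_mem Ω.isOpen.measurableSet] with x h1 h2 h3
    refine tendsto_nhds_unique h1 ?_
    simp_rw [h2]
    exact (hlim x h3).comp hns.tendsto_atTop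

open TopologicalSpace in
instance completeSpace_bergmanSpace (Ω : Opens (ℂ × ℂ)) : CompleteSpace (bergmanSpace Ω) :=
  (isClosed_bergmanSpace Ω).completeSpace_coe

open TopologicalSpace in
/-- The Bergman projection: the orthogonal projection from `L²(Ω)` onto `A²(Ω)`. -/
noncomputable def bergmanProjection (Ω : Opens (ℂ × ℂ)) :
    Lp ℂ 2 (volume.restrict (Ω : Set (ℂ × ℂ))) →L[ℂ] bergmanSpace Ω :=
  (bergmanSpace Ω).orthogonalProjectionOnto

open TopologicalSpace in
/-- The Toeplitz operator `f ↦ B_Ω (u f)` on `A²(Ω)` with an essentially bounded symbol `u`. -/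
noncomputable def toeplitz (Ω : Opens (ℂ × ℂ)) (u : ℂ × ℂ → ℂ)
    (hu : MemLp u ∞ (volume.restrict (Ω : Set (ℂ × ℂ)))) :
    bergmanSpace Ω →ₗ[ℂ] bergmanSpace Ω where
  toFun f := bergmanProjection Ω
    (hu.toLp u • (f : Lp ℂ 2 (volume.restrict (Ω : Set (ℂ × ℂ)))) :)
  map_add' f g := by rw [Submodule.coe_add, Lp.add_smul, map_add]
  map_smul' c f := by
    rw [Submodule.coe_smul, ← Lp.smul_comm, map_smul, RingHom.id_apply]

noncomputable section

namespace Reinhardt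

def X : Set (ℂ × ℂ) :=
  {z | Real.exp 1 < ‖z.1‖ ∧ ‖z.2‖ < 1 / (‖z.1‖ * Real.log ‖z.1‖)}

def Y (m : ℕ) : Set (ℂ × ℂ) :=
  {z | 2 < ‖z.2‖ ∧ |‖z.1‖ - 1 / ‖z.2‖| < 1 / ‖z.2‖ ^ m}

def Z : Set (ℂ × ℂ) := {z | ‖z.1‖ ≤ Real.exp 1 ∧ ‖z.2‖ ≤ 2}

/-- The Reinhardt domain `Ω_m`. The union `X ∪ Y_m ∪ Z` contains boundary points of `Z`, so it is
its interior that is the (open) domain; the two differ by a null set. -/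
def Omega (m : ℕ) : TopologicalSpace.Opens (ℂ × ℂ) :=
  TopologicalSpace.Opens.interior (X ∪ Y m ∪ Z)

/-- The symbol `z₁ / conj z₁` (with the value `0` on the null set `z₁ = 0`). -/
def phi (z : ℂ × ℂ) : ℂ := z.1 / conj z.1

theorem memLp_phi (μ : Measure (ℂ × ℂ)) : MemLp phi ∞ μ := by
  refine memLp_top_of_bound ?_ 1 (ae_of_all _ fun z => ?_)
  · refine Measurable.aestronglyMeasurable ?_
    exact measurable_fst.div (Complex.continuous_conj.measurable.comp measurable_fst)
  · rw [phi, norm_div, RCLike.norm_conj]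
    exact div_self_le_one _

/-- The Toeplitz operator `T_φ` on `A²(Ω_m)` with symbol `φ = z₁ / conj z₁`. -/
def Tphi (m : ℕ) : bergmanSpace (Omega m) →ₗ[ℂ] bergmanSpace (Omega m) :=
  toeplitz (Omega m) phi (memLp_phi _)

/-- The monomial `z₁ ^ a * z₂ ^ b`. -/
def monom (a b : ℕ) (z : ℂ × ℂ) : ℂ := z.1 ^ a * z.2 ^ b

/-- `f ∈ A²(Ω_m)` is (the class of) the monomial `z₁ ^ a * z₂ ^ b`. -/
def IsMono (m : ℕ) (f : bergmanSpace (Omega m)) (a b : ℕ) : Prop :=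
  (f : Lp ℂ 2 (volume.restrict (Omega m : Set (ℂ × ℂ))))
    =ᵐ[volume.restrict (Omega m : Set (ℂ × ℂ))] monom a b

/-- The number `c_{(a,b)}²`, the integral of `|z₁ ^ a * z₂ ^ b|²` over `Ω_m`. -/
def cSq (m a b : ℕ) : ℝ := ∫ z in (Omega m : Set (ℂ × ℂ)), ‖monom a b z‖ ^ 2

/-- The lattice `R_m` of exponents. -/
def R (m : ℕ) : Set (ℕ × ℕ) :=
  {α | α.1 ≤ α.2 ∧ (α.2 : ℝ) - ((m : ℝ) - 1) / 2 < α.1}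

end Reinhardt

end

/-! Everything rests on the torus symmetry of the domain. Rotating the coordinates preserves `core
m`, which has full measure in `Omega m`, so a holomorphic function splits into Fourier modes under
the torus. Cauchy's theorem along the curves `l ↦ (l ^ p * z₁, l ^ q * z₂)` shows that a mode
divided by its Laurent monomial is constant along scalings. Such scalings join every point off the
axes to the bidisc, so each mode is a constant times a monomial (`coeff_eq`), and boundedness near
the origin kills negative exponents (`coeff_eq_zero_of_neg`). Taking a mode contracts the `L²` norm,
so every monomial that occurs is itself square integrable. Hence an element of `A²` orthogonal to
all monomials in `A²` vanishes (`eq_zero_of_orthogonal_monom`), and identities in `A²` may be tested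
against monomials.

Polar coordinates decide which monomials occur. The horn `X` forces `a ≤ b`, with the logarithm
rescuing the diagonal `a = b`. The horn `Y m` has width of order `|z₂| ^ (-m)` around `|z₁| = 1 /
|z₂|`, which forces `2b - 2a - m < -1`. Together these give `R m`, whose slice at fixed `b` is an
interval of bounded length ending at `a = b`.

The symbol has torus weight `(2, 0)`, so `T_φ` sends the monomial of exponent `(a, b)` to a multiple
of that of exponent `(a + 2, b)`. The multiple is nonzero when the target lies in `R m`, and the
image is zero otherwise. A chain of `k` steps fits into a slice exactly when `4k + 1 < m`, that is
`k < (m + 2) / 4` in natural division. This gives the nilpotency degree; as a chain of one step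
exists on infinitely many slices when `m ≥ 6`, the rank is infinite. -/

noncomputable section

namespace Reinhardt

/-! ### Torus action and Fourier modes -/

open AddCircle

instance fact_two_pi_pos : Fact (0 < 2 * Real.pi) := ⟨Real.two_pi_pos⟩

/-- The two-dimensional torus. -/
abbrev Torus : Type := AddCircle (2 * Real.pi) × AddCircle (2 * Real.pi)

/-- The normalized Haar measure of the torus. -/
abbrev torusMeasure : Measure Torus := haarAddCircle.prod haarAddCircle

/-- The action of the torus on `ℂ²` by rotations of the coordinates. -/
def rot (x : Torus) (z : ℂ × ℂ) : ℂ × ℂ := (fourier 1 x.1 * z.1, fourier 1 x.2 * z.2)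

/-- The characters of the torus. -/
def chi (n k : ℤ) (x : Torus) : ℂ := fourier n x.1 * fourier k x.2

/-- The Fourier mode of `g` of frequency `(n, k)` under the torus action. -/
def mode (n k : ℤ) (g : ℂ × ℂ → ℂ) (z : ℂ × ℂ) : ℂ :=
  ∫ x, g (rot x z) * chi (-n) (-k) x ∂torusMeasure

def TorusInvariant (U : Set (ℂ × ℂ)) : Prop := ∀ x : Torus, ∀ z ∈ U, rot x z ∈ U

theorem fourier_eq_zpow {T : ℝ} (n : ℤ) (w : AddCircle T) : fourier n w = (fourier 1 w) ^ n := by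
  rw [fourier_apply, fourier_one, AddCircle.toCircle_zsmul, Circle.coe_zpow]

theorem fourier_one_ne_zero {T : ℝ} (w : AddCircle T) : fourier 1 w ≠ 0 := by
  rw [fourier_one]; exact Circle.coe_ne_zero _

theorem norm_fourier_apply {T : ℝ} (n : ℤ) (w : AddCircle T) : ‖fourier n w‖ = 1 := by
  rw [fourier_apply]; exact Circle.norm_coe _

theorem fourier_apply_add {T : ℝ} (n : ℤ) (v w : AddCircle T) :
    fourier n (v + w) = fourier n v * fourier n w := by
  rw [fourier_apply, fourier_apply, fourier_apply, smul_add, AddCircle.toCircle_add, Circle.coe_mul]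

theorem fourier_apply_zsmul {T : ℝ} (n p : ℤ) (w : AddCircle T) :
    fourier n (p • w) = fourier (n * p) w := by
  rw [fourier_apply, fourier_apply, smul_smul]

theorem fourier_one_coe (θ : ℝ) : fourier 1 (θ : AddCircle (2 * Real.pi)) = circleMap 0 1 θ := by
  rw [fourier_coe_apply, circleMap]
  have := Real.pi_ne_zero
  simp
  field_simp

theorem integral_haar_eq (F : AddCircle (2 * Real.pi) → ℂ) :
    ∫ w, F w ∂haarAddCircle = (2 * Real.pi)⁻¹ • ∫ θ in 0..2 * Real.pi, F θ := by
  rw [integral_haarAddCircle, ← AddCircle.intervalIntegral_preimage _ 0, zero_add]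

theorem circleIntegral_inv_smul (f : ℂ → ℂ) {r : ℝ} (hr : r ≠ 0) :
    (∮ z in C(0, r), (z - 0)⁻¹ • f z) =
      Complex.I * ∫ θ in 0..2 * Real.pi, f (circleMap 0 r θ) := by
  rw [circleIntegral, ← intervalIntegral.integral_const_mul]
  refine intervalIntegral.integral_congr fun θ _ => ?_
  have : circleMap 0 r θ ≠ 0 := circleMap_ne_center hr
  simp only [deriv_circleMap, smul_eq_mul, sub_zero]
  field_simp

theorem integral_haar_circle (h : ℂ → ℂ) (N : ℤ) {r : ℝ} (hr : 0 < r) :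
    ∫ w : AddCircle (2 * Real.pi), h (r * fourier 1 w) * fourier (-N) w ∂haarAddCircle =
      (r : ℂ) ^ N * ((2 * Real.pi)⁻¹ • ∫ θ in 0..2 * Real.pi,
        (circleMap 0 r θ) ^ (-N) * h (circleMap 0 r θ)) := by
  have hr' : (r : ℂ) ≠ 0 := by exact_mod_cast hr.ne'
  rw [integral_haar_eq, mul_smul_comm, ← intervalIntegral.integral_const_mul]
  congr 1
  refine intervalIntegral.integral_congr fun θ _ => ?_
  have h1 : circleMap 0 r θ = r * circleMap 0 1 θ := by simp [circleMap]
  rw [fourier_eq_zpow (-N), fourier_one_coe, h1, mul_zpow, zpow_neg (r : ℂ)]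
  field_simp

/-- Cauchy's theorem on an annulus, applied to `z ^ (-N) * h z`: the `N`-th Laurent coefficient does
not depend on the radius of the circle. -/
theorem integral_circle_scale {h : ℂ → ℂ} {t : ℝ} (ht : 0 < t) (ht1 : t ≤ 1) (N : ℤ)
    (hd : ∀ l : ℂ, t ≤ ‖l‖ → ‖l‖ ≤ 1 → DifferentiableAt ℂ h l) :
    ∫ w : AddCircle (2 * Real.pi), h (t * fourier 1 w) * fourier (-N) w ∂haarAddCircle =
      (t : ℂ) ^ N *
        ∫ w : AddCircle (2 * Real.pi), h (fourier 1 w) * fourier (-N) w ∂haarAddCircle := by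
  have hd' : ∀ l : ℂ, t ≤ ‖l‖ → ‖l‖ ≤ 1 → DifferentiableAt ℂ (fun z => z ^ (-N) * h z) l := by
    intro l h1 h2
    refine DifferentiableAt.mul (differentiableAt_zpow.2 (Or.inl ?_)) (hd l h1 h2)
    exact norm_pos_iff.1 (ht.trans_le h1)
  have key := Complex.circleIntegral_sub_center_inv_smul_eq_of_differentiable_on_annulus_off_countable
    (c := 0) ht ht1 (f := fun z => z ^ (-N) * h z) Set.countable_empty
    (fun z hz => (hd' z (by simpa using hz.2) (by simpa using hz.1)).continuousAt.continuousWithinAt)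
    (fun z hz => hd' z (by simpa using (not_le.1 (fun h => hz.1.2 (by simpa using h))).le)
      (by simpa using (mem_ball_zero_iff.1 hz.1.1).le))
  rw [circleIntegral_inv_smul _ one_ne_zero, circleIntegral_inv_smul _ ht.ne'] at key
  have h1 := integral_haar_circle h N one_pos
  simp only [Complex.ofReal_one, one_mul, one_zpow] at h1
  rw [integral_haar_circle h N ht, h1, mul_left_cancel₀ Complex.I_ne_zero key]

theorem continuous_rot : Continuous fun p : Torus × (ℂ × ℂ) => rot p.1 p.2 := by
  unfold rot; fun_prop

theorem continuous_chi (n k : ℤ) : Continuous (chi n k) := by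
  unfold chi; fun_prop

theorem norm_chi (n k : ℤ) (x : Torus) : ‖chi n k x‖ = 1 := by
  rw [chi, norm_mul, norm_fourier_apply, norm_fourier_apply, one_mul]

theorem chi_ne_zero (n k : ℤ) (x : Torus) : chi n k x ≠ 0 := by
  rw [← norm_pos_iff, norm_chi]; exact one_pos

theorem chi_add (n k : ℤ) (x y : Torus) : chi n k (x + y) = chi n k x * chi n k y := by
  simp only [chi, Prod.fst_add, Prod.snd_add, fourier_apply_add]; ring

theorem chi_neg (n k : ℤ) (x : Torus) : chi (-n) (-k) x = (chi n k x)⁻¹ := by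
  rw [chi, chi, fourier_eq_zpow (-n), fourier_eq_zpow (-k), fourier_eq_zpow n, fourier_eq_zpow k,
    zpow_neg, zpow_neg, mul_inv]

theorem rot_add (x y : Torus) (z : ℂ × ℂ) : rot (x + y) z = rot x (rot y z) := by
  simp only [rot, Prod.fst_add, Prod.snd_add, fourier_apply_add, mul_assoc]

theorem rot_zero (z : ℂ × ℂ) : rot 0 z = z := by
  simp [rot]

theorem norm_rot_fst (x : Torus) (z : ℂ × ℂ) : ‖(rot x z).1‖ = ‖z.1‖ := by
  rw [rot, norm_mul, norm_fourier_apply, one_mul]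

theorem norm_rot_snd (x : Torus) (z : ℂ × ℂ) : ‖(rot x z).2‖ = ‖z.2‖ := by
  rw [rot, norm_mul, norm_fourier_apply, one_mul]

theorem continuous_comp_rot {U : Set (ℂ × ℂ)} (hU : TorusInvariant U) {g : ℂ × ℂ → ℂ}
    (hg : ContinuousOn g U) {z : ℂ × ℂ} (hz : z ∈ U) : Continuous fun x => g (rot x z) :=
  hg.comp_continuous (continuous_rot.comp (by fun_prop : Continuous fun x : Torus => (x, z)))
    fun x => hU x z hz

theorem mode_rot (n k : ℤ) (g : ℂ × ℂ → ℂ) (y : Torus) (z : ℂ × ℂ) :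
    mode n k g (rot y z) = chi n k y * mode n k g z := by
  have h := integral_add_right_eq_self (μ := torusMeasure)
    (fun x => g (rot x z) * chi (-n) (-k) x) y
  rw [mode, mode, ← h, ← integral_const_mul]
  refine integral_congr_ae (ae_of_all _ fun x => ?_)
  simp only
  rw [rot_add, chi_add, chi_neg n k y]
  have := chi_ne_zero n k y
  field_simp

/-- Haar invariance allows an extra average over the one-parameter subgroup `w ↦ (p • w, q • w)`.
The inner integral is then a one-variable Laurent coefficient, of index `n * p + k * q`, to which
Cauchy's theorem applies. -/
theorem mode_average {U : Set (ℂ × ℂ)} (hU : TorusInvariant U) {g : ℂ × ℂ → ℂ}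
    (hg : ContinuousOn g U) {z : ℂ × ℂ} (hz : z ∈ U) (n k p q : ℤ) :
    mode n k g z = ∫ x, chi (-n) (-k) x *
      ∫ w : AddCircle (2 * Real.pi),
        g (rot x ((fourier 1 w) ^ p * z.1, (fourier 1 w) ^ q * z.2)) *
          fourier (-(n * p + k * q)) w ∂haarAddCircle ∂torusMeasure := by
  have hrot : ∀ (x : Torus) (w : AddCircle (2 * Real.pi)),
      rot (x + (p • w, q • w)) z = rot x ((fourier 1 w) ^ p * z.1, (fourier 1 w) ^ q * z.2) := by
    intro x w
    rw [rot_add]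
    simp only [rot, fourier_apply_zsmul, one_mul]
    rw [fourier_eq_zpow p, fourier_eq_zpow q]
  have hchi : ∀ w : AddCircle (2 * Real.pi),
      chi (-n) (-k) (p • w, q • w) = fourier (-(n * p + k * q)) w := by
    intro w
    rw [chi, fourier_apply_zsmul, fourier_apply_zsmul, ← fourier_add]
    ring_nf
  have h1 : ∀ w : AddCircle (2 * Real.pi), mode n k g z =
      ∫ x, chi (-n) (-k) x * (g (rot x ((fourier 1 w) ^ p * z.1, (fourier 1 w) ^ q * z.2)) *
        fourier (-(n * p + k * q)) w) ∂torusMeasure := by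
    intro w
    rw [mode, ← integral_add_right_eq_self (μ := torusMeasure) _ ((p • w, q • w) : Torus)]
    refine integral_congr_ae (ae_of_all _ fun x => ?_)
    simp only
    rw [hrot, chi_add, hchi]
    ring
  -- The mode is constant in `w` and the measure has mass one, so averaging over `w` changes
  -- nothing; Fubini then moves that average inside.
  have h2 : mode n k g z = ∫ w : AddCircle (2 * Real.pi), mode n k g z ∂haarAddCircle := by
    simp
  rw [h2]
  simp_rw [← integral_const_mul]
  rw [integral_integral_swap]
  · exact integral_congr_ae (ae_of_all _ fun w => h1 w)
  · refine Continuous.integrable_of_hasCompactSupport ?_ (HasCompactSupport.of_compactSpace _)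
    simp only [Function.uncurry_def]
    simp_rw [← hrot]
    have h3 : Continuous fun a : Torus × AddCircle (2 * Real.pi) =>
        g (rot (a.1 + (p • a.2, q • a.2)) z) :=
      (continuous_comp_rot hU hg hz).comp (by fun_prop)
    exact ((continuous_chi (-n) (-k)).comp continuous_fst).mul
      (h3.mul ((fourier _).continuous.comp continuous_snd))

/-- A mode is homogeneous along `l ↦ (l ^ p * z₁, l ^ q * z₂)`. Only the real segment has to be
checked to lie in `U`, since torus invariance supplies the rest of the annulus. -/
theorem mode_scale {U : Set (ℂ × ℂ)} (hUo : IsOpen U) (hU : TorusInvariant U) {g : ℂ × ℂ → ℂ}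
    (hg : DifferentiableOn ℂ g U) {z : ℂ × ℂ} (n k p q : ℤ) {t : ℝ} (ht : 0 < t) (ht1 : t ≤ 1)
    (hp : ∀ s : ℝ, t ≤ s → s ≤ 1 → ((s : ℂ) ^ p * z.1, (s : ℂ) ^ q * z.2) ∈ U) :
    mode n k g ((t : ℂ) ^ p * z.1, (t : ℂ) ^ q * z.2) =
      (t : ℂ) ^ (n * p + k * q) * mode n k g z := by
  have hz : z ∈ U := by simpa using hp 1 ht1 le_rfl
  rw [mode_average hU hg.continuousOn (hp t le_rfl ht1) n k p q,
    mode_average hU hg.continuousOn hz n k p q, ← integral_const_mul]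
  refine integral_congr_ae (ae_of_all _ fun x => ?_)
  simp only
  rw [mul_left_comm, ← integral_circle_scale
    (h := fun l : ℂ => g (rot x (l ^ p * z.1, l ^ q * z.2))) ht ht1]
  · simp only [mul_zpow]
    congr 2; ext w; congr 4 <;> ring_nf
  · intro l h1 h2
    have hl0 : l ≠ 0 := norm_pos_iff.1 (ht.trans_le h1)
    -- Write `l` as its modulus times a unit; the unit acts through the torus.
    have hmem : rot x (l ^ p * z.1, l ^ q * z.2) ∈ U := by
      have h3 : l = ‖l‖ * fourier 1 ((Complex.arg l : ℝ) : AddCircle (2 * Real.pi)) := by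
        rw [fourier_one_coe]
        simp [circleMap]
      set u := fourier 1 ((Complex.arg l : ℝ) : AddCircle (2 * Real.pi)) with hu
      have h4 := hU (x + (p • ((Complex.arg l : ℝ) : AddCircle (2 * Real.pi)),
        q • ((Complex.arg l : ℝ) : AddCircle (2 * Real.pi)))) _ (hp ‖l‖ h1 h2)
      convert h4 using 1
      rw [rot_add]
      congr 1
      simp only [rot, fourier_apply_zsmul, one_mul]
      rw [fourier_eq_zpow p, fourier_eq_zpow q, ← hu]
      conv_lhs => rw [h3, mul_zpow, mul_zpow]
      congr 1 <;> ring
    refine DifferentiableAt.fun_comp' l (hg.differentiableAt (hUo.mem_nhds hmem)) ?_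
    have hzp : ∀ r : ℤ, DifferentiableAt ℂ (fun l : ℂ => l ^ r) l := fun r =>
      differentiableAt_zpow.2 (Or.inl hl0)
    unfold rot
    exact (((hzp p).mul_const _).const_mul _).prodMk (((hzp q).mul_const _).const_mul _)

/-! ### Uniqueness from Fourier modes -/

theorem eq_zero_of_fourierCoeff_eq_zero {f : AddCircle (2 * Real.pi) → ℂ} (hf : Continuous f)
    (h : ∀ n, fourierCoeff f n = 0) (x : AddCircle (2 * Real.pi)) : f x = 0 := by
  have h0 : fourierCoeff (⟨f, hf⟩ : C(AddCircle (2 * Real.pi), ℂ)) = 0 := funext h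
  have hs := has_pointwise_sum_fourier_series_of_summable
    (f := (⟨f, hf⟩ : C(AddCircle (2 * Real.pi), ℂ))) (by rw [h0]; exact summable_zero) x
  rw [h0] at hs
  simp only [Pi.zero_apply, zero_smul, ContinuousMap.coe_mk] at hs
  exact hs.unique hasSum_zero

/-- One-variable uniqueness is used twice: first in `y`, for the `n`-th coefficient in `x` as a
function of `y`, and then in `x`. -/
theorem eq_zero_of_mode_eq_zero {U : Set (ℂ × ℂ)} (hU : TorusInvariant U) {g : ℂ × ℂ → ℂ}
    (hg : ContinuousOn g U) {z : ℂ × ℂ} (hz : z ∈ U) (h : ∀ n k, mode n k g z = 0) : g z = 0 := by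
  set F : Torus → ℂ := fun x => g (rot x z) with hF
  have hFc : Continuous F := continuous_comp_rot hU hg hz
  have h1 : ∀ n y, fourierCoeff (fun x => F (x, y)) n = 0 := by
    intro n
    refine eq_zero_of_fourierCoeff_eq_zero ?_ fun k => ?_
    · simp only [fourierCoeff]
      have hc : Continuous (Function.uncurry
          fun y x : AddCircle (2 * Real.pi) => fourier (-n) x • F (x, y)) := by
        simp only [Function.uncurry_def]; fun_prop
      simpa using continuous_parametric_integral_of_continuous (μ := haarAddCircle) hc
        isCompact_univ
    · rw [← h n k, mode, integral_prod_symm]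
      · simp only [fourierCoeff, smul_eq_mul, ← integral_const_mul]
        refine integral_congr_ae (ae_of_all _ fun y => integral_congr_ae (ae_of_all _ fun x => ?_))
        simp only [hF, chi]; ring
      · refine Continuous.integrable_of_hasCompactSupport ?_ (HasCompactSupport.of_compactSpace _)
        exact hFc.mul (continuous_chi _ _)
  have h2 := eq_zero_of_fourierCoeff_eq_zero (f := fun x => F (x, 0)) (by fun_prop)
    (fun n => h1 n 0) 0
  simpa [hF, Prod.mk_zero_zero, rot_zero] using h2

/-! ### An explicit open set of full measure -/

/-- The open bidisc of radii `e` and `2`. -/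
def polydisc : Set (ℂ × ℂ) := {z | ‖z.1‖ < Real.exp 1 ∧ ‖z.2‖ < 2}

/-- The part of the domain along the `z₁`-axis, enlarged so that it overlaps the bidisc. -/
def hornX : Set (ℂ × ℂ) :=
  {z | 1 < ‖z.1‖ ∧ ‖z.2‖ < 2 ∧ ‖z.2‖ * (‖z.1‖ * Real.log ‖z.1‖) < 1}

/-- The part of the domain along the `z₂`-axis, enlarged so that it overlaps the bidisc. -/
def hornY (m : ℕ) : Set (ℂ × ℂ) :=
  {z | 1 < ‖z.2‖ ∧ ‖z.1‖ < Real.exp 1 ∧ |‖z.1‖ * ‖z.2‖ - 1| * ‖z.2‖ ^ (m - 1) < 1}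

/-- An open subset of `Omega m` of full measure that is described explicitly. -/
def core (m : ℕ) : Set (ℂ × ℂ) := polydisc ∪ hornX ∪ hornY m

theorem isOpen_polydisc : IsOpen polydisc := by
  refine IsOpen.and ?_ ?_ <;> exact isOpen_lt (by fun_prop) (by fun_prop)

theorem isOpen_hornX : IsOpen hornX := by
  have h1 : IsOpen {z : ℂ × ℂ | 1 < ‖z.1‖} := isOpen_lt (by fun_prop) (by fun_prop)
  have h2 : ContinuousOn (fun z : ℂ × ℂ => ‖z.2‖ * (‖z.1‖ * Real.log ‖z.1‖))
      {z : ℂ × ℂ | 1 < ‖z.1‖} := by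
    refine ContinuousOn.mul (by fun_prop) (ContinuousOn.mul (by fun_prop)
      (ContinuousOn.log (by fun_prop) fun z hz => ?_))
    have : (1 : ℝ) < ‖z.1‖ := hz
    positivity
  have h3 := h2.isOpen_inter_preimage h1 isOpen_Iio (t := Set.Iio 1)
  have h4 : IsOpen {z : ℂ × ℂ | ‖z.2‖ < 2} := isOpen_lt (by fun_prop) (by fun_prop)
  convert h3.inter h4 using 1
  ext z
  simp only [hornX, Set.mem_ofPred_eq, Set.mem_inter_iff, Set.mem_preimage, Set.mem_Iio]
  tauto

theorem isOpen_hornY (m : ℕ) : IsOpen (hornY m) := by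
  refine IsOpen.and ?_ (IsOpen.and ?_ ?_) <;> exact isOpen_lt (by fun_prop) (by fun_prop)

theorem isOpen_core (m : ℕ) : IsOpen (core m) :=
  (isOpen_polydisc.union isOpen_hornX).union (isOpen_hornY m)

theorem torusInvariant_core (m : ℕ) : TorusInvariant (core m) := by
  intro x z hz
  simpa only [core, polydisc, hornX, hornY, Set.mem_union, Set.mem_ofPred_eq, norm_rot_fst,
    norm_rot_snd] using hz

/-- Multiplying by `s ^ m` expresses the condition through `r * s`, which is invariant under the
scaling used along this horn. -/
theorem abs_sub_one_div_lt_iff {m : ℕ} (hm : 1 ≤ m) {r s : ℝ} (hs : 0 < s) :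
    |r - 1 / s| < 1 / s ^ m ↔ |r * s - 1| * s ^ (m - 1) < 1 := by
  obtain ⟨k, rfl⟩ : ∃ k, m = k + 1 := ⟨m - 1, by omega⟩
  have h1 : r - 1 / s = (r * s - 1) / s := by field_simp
  rw [h1, abs_div, abs_of_pos hs, lt_div_iff₀ (by positivity), Nat.add_sub_cancel, pow_succ]
  rw [show |r * s - 1| / s * (s ^ k * s) = |r * s - 1| * s ^ k by field_simp]

theorem core_subset {m : ℕ} (hm : 1 ≤ m) : core m ⊆ X ∪ Y m ∪ Z := by
  rintro z ((hz | hz) | hz)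
  · exact Or.inr ⟨hz.1.le, hz.2.le⟩
  · obtain ⟨h1, h2, h3⟩ := hz
    rcases lt_or_ge (Real.exp 1) ‖z.1‖ with h | h
    · refine Or.inl (Or.inl ⟨h, ?_⟩)
      have : 0 < Real.log ‖z.1‖ := Real.log_pos h1
      rwa [lt_div_iff₀ (by positivity)]
    · exact Or.inr ⟨h, h2.le⟩
  · obtain ⟨h1, h2, h3⟩ := hz
    rcases lt_or_ge 2 ‖z.2‖ with h | h
    · exact Or.inl (Or.inr ⟨h, (abs_sub_one_div_lt_iff hm (by linarith)).2 h3⟩)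
    · exact Or.inr ⟨h2.le, h⟩

theorem core_subset_Omega {m : ℕ} (hm : 1 ≤ m) : core m ⊆ (Omega m : Set (ℂ × ℂ)) :=
  interior_maximal (core_subset hm) (isOpen_core m)

theorem two_lt_exp_one : (2 : ℝ) < Real.exp 1 := by
  have := Real.exp_one_gt_d9; linarith

theorem X_subset_hornX : X ⊆ hornX := by
  rintro z ⟨h1, h2⟩
  have he := two_lt_exp_one
  have hl : 1 < Real.log ‖z.1‖ := by
    rw [← Real.log_exp 1]; exact Real.log_lt_log (Real.exp_pos 1) h1
  have h3 : 1 < ‖z.1‖ * Real.log ‖z.1‖ := by nlinarith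
  refine ⟨by linarith, ?_, by rwa [lt_div_iff₀ (by linarith)] at h2⟩
  refine h2.trans ?_
  rw [div_lt_iff₀ (by linarith)]
  linarith

theorem Y_subset_hornY {m : ℕ} (hm : 1 ≤ m) : Y m ⊆ hornY m := by
  rintro z ⟨h1, h2⟩
  have he := two_lt_exp_one
  have h3 : 1 / ‖z.2‖ ^ m ≤ 1 := by
    rw [div_le_one (by positivity)]; exact one_le_pow₀ (by linarith)
  have h4 : 1 / ‖z.2‖ ≤ 1 := by
    rw [div_le_one (by positivity)]; linarith
  refine ⟨by linarith, ?_, (abs_sub_one_div_lt_iff hm (by linarith)).1 h2⟩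
  have := (abs_lt.1 h2).2
  linarith

theorem ae_norm_fst_ne (r : ℝ) (hr : r ≠ 0) : ∀ᵐ z : ℂ × ℂ, ‖z.1‖ ≠ r := by
  have h : ∀ᵐ z : ℂ, ‖z‖ ≠ r := by
    have := Measure.addHaar_sphere_of_ne_zero (volume : Measure ℂ) 0 hr
    rw [measure_eq_zero_iff_ae_notMem] at this
    filter_upwards [this] with z hz h using hz (by simpa using h)
  exact Measure.quasiMeasurePreserving_fst.ae h

theorem ae_norm_snd_ne (r : ℝ) (hr : r ≠ 0) : ∀ᵐ z : ℂ × ℂ, ‖z.2‖ ≠ r := by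
  have h : ∀ᵐ z : ℂ, ‖z‖ ≠ r := by
    have := Measure.addHaar_sphere_of_ne_zero (volume : Measure ℂ) 0 hr
    rw [measure_eq_zero_iff_ae_notMem] at this
    filter_upwards [this] with z hz h using hz (by simpa using h)
  exact Measure.quasiMeasurePreserving_snd.ae h

theorem ae_ne_zero : ∀ᵐ z : ℂ × ℂ, z.1 ≠ 0 ∧ z.2 ≠ 0 := by
  have h : ∀ᵐ z : ℂ, z ≠ 0 := by simp [ae_iff]
  exact (Measure.quasiMeasurePreserving_fst.ae h).and (Measure.quasiMeasurePreserving_snd.ae h)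

/-- The two sets can differ only where `|z₁| = e` or `|z₂| = 2`, which is a null set. -/
theorem Omega_ae_eq_core {m : ℕ} (hm : 1 ≤ m) :
    (Omega m : Set (ℂ × ℂ)) =ᵐ[volume] core m := by
  filter_upwards [ae_norm_fst_ne _ (Real.exp_pos 1).ne', ae_norm_snd_ne 2 two_ne_zero] with z h1 h2
  refine propext ⟨fun hz => ?_, fun hz => core_subset_Omega hm hz⟩
  rcases interior_subset hz with (h | h) | h
  · exact Or.inl (Or.inr (X_subset_hornX h))
  · exact Or.inr (Y_subset_hornY hm h)
  · exact Or.inl (Or.inl ⟨h.1.lt_of_ne h1, h.2.lt_of_ne h2⟩)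

theorem restrict_Omega {m : ℕ} (hm : 1 ≤ m) :
    volume.restrict (Omega m : Set (ℂ × ℂ)) = volume.restrict (core m) :=
  Measure.restrict_congr_set (Omega_ae_eq_core hm)

/-! ### Modes of holomorphic functions are monomials -/

/-- The mode of `g` of frequency `(n, k)`, divided by the Laurent monomial `z₁ ^ n * z₂ ^ k`. -/
def coeff (n k : ℤ) (g : ℂ × ℂ → ℂ) (z : ℂ × ℂ) : ℂ := mode n k g z * (z.1 ^ (-n) * z.2 ^ (-k))

theorem mode_eq_coeff_mul (n k : ℤ) (g : ℂ × ℂ → ℂ) {z : ℂ × ℂ} (h1 : z.1 ≠ 0) (h2 : z.2 ≠ 0) :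
    mode n k g z = coeff n k g z * (z.1 ^ n * z.2 ^ k) := by
  rw [coeff, zpow_neg, zpow_neg]
  have := zpow_ne_zero n h1
  have := zpow_ne_zero k h2
  field_simp

theorem coeff_rot (n k : ℤ) (g : ℂ × ℂ → ℂ) (y : Torus) (z : ℂ × ℂ) :
    coeff n k g (rot y z) = coeff n k g z := by
  rw [coeff, coeff, mode_rot]
  have h1 := fourier_one_ne_zero y.1
  have h2 := fourier_one_ne_zero y.2
  simp only [rot, mul_zpow, chi]
  rw [fourier_eq_zpow n, fourier_eq_zpow k, zpow_neg (fourier 1 y.1), zpow_neg (fourier 1 y.2)]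
  field_simp

theorem coeff_norm (n k : ℤ) (g : ℂ × ℂ → ℂ) (z : ℂ × ℂ) :
    coeff n k g z = coeff n k g ((‖z.1‖ : ℂ), (‖z.2‖ : ℂ)) := by
  rw [← coeff_rot n k g (((Complex.arg z.1 : ℝ) : AddCircle (2 * Real.pi)),
    ((Complex.arg z.2 : ℝ) : AddCircle (2 * Real.pi))) ((‖z.1‖ : ℂ), (‖z.2‖ : ℂ))]
  congr 1
  simp only [rot, fourier_one_coe, circleMap, zero_add, Complex.ofReal_one, one_mul]
  ext
  · simp [mul_comm (Complex.exp _)]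
  · simp [mul_comm (Complex.exp _)]

/-- The mode and the Laurent monomial pick up the same factor `t ^ (n * p + k * q)`, so it cancels.
-/
theorem coeff_scale {U : Set (ℂ × ℂ)} (hUo : IsOpen U) (hU : TorusInvariant U) {g : ℂ × ℂ → ℂ}
    (hg : DifferentiableOn ℂ g U) {z : ℂ × ℂ} (n k p q : ℤ) {t : ℝ} (ht : 0 < t) (ht1 : t ≤ 1)
    (hp : ∀ s : ℝ, t ≤ s → s ≤ 1 → ((s : ℂ) ^ p * z.1, (s : ℂ) ^ q * z.2) ∈ U) :
    coeff n k g ((t : ℂ) ^ p * z.1, (t : ℂ) ^ q * z.2) = coeff n k g z := by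
  rw [coeff, coeff, mode_scale hUo hU hg n k p q ht ht1 hp]
  have ht' : (t : ℂ) ≠ 0 := by exact_mod_cast ht.ne'
  simp only [mul_zpow, ← zpow_mul]
  rw [zpow_add₀ ht', mul_neg, mul_neg, zpow_neg _ (p * n), zpow_neg _ (q * k), mul_comm p,
    mul_comm q]
  have := zpow_ne_zero (n * p) ht'
  have := zpow_ne_zero (k * q) ht'
  field_simp

theorem coeff_fst_of_le {m : ℕ} {g : ℂ × ℂ → ℂ} (hg : DifferentiableOn ℂ g (core m))
    (n k : ℤ)
    {r r' : ℝ} {w : ℂ} (hr : 0 < r) (hrr : r ≤ r') (hr' : r' < Real.exp 1)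
    (hw : ‖w‖ < 2) : coeff n k g ((r : ℂ), w) = coeff n k g ((r' : ℂ), w) := by
  have h0 : 0 < r' := hr.trans_le hrr
  have h0' : (r' : ℂ) ≠ 0 := by exact_mod_cast h0.ne'
  have := coeff_scale (isOpen_core m) (torusInvariant_core m) hg (z := ((r' : ℂ), w)) n k 1 0
    (t := r / r') (by positivity) (by rwa [div_le_one h0]) (fun s hs hs1 => ?_)
  · rw [← this]
    simp only [zpow_one, zpow_zero, one_mul]
    congr 2
    push_cast
    field_simp
  · refine Or.inl (Or.inl ⟨?_, by simpa using hw⟩)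
    have : 0 < s := lt_of_lt_of_le (by positivity) hs
    simp only [zpow_one, norm_mul, Complex.norm_real, Real.norm_eq_abs, abs_of_pos this,
      abs_of_pos h0]
    nlinarith

theorem coeff_snd_of_le {m : ℕ} {g : ℂ × ℂ → ℂ} (hg : DifferentiableOn ℂ g (core m))
    (n k : ℤ)
    {r r' : ℝ} {w : ℂ} (hr : 0 < r) (hrr : r ≤ r') (hr' : r' < 2)
    (hw : ‖w‖ < Real.exp 1) : coeff n k g (w, (r : ℂ)) = coeff n k g (w, (r' : ℂ)) := by
  have h0 : 0 < r' := hr.trans_le hrr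
  have h0' : (r' : ℂ) ≠ 0 := by exact_mod_cast h0.ne'
  have := coeff_scale (isOpen_core m) (torusInvariant_core m) hg (z := (w, (r' : ℂ))) n k 0 1
    (t := r / r') (by positivity) (by rwa [div_le_one h0]) (fun s hs hs1 => ?_)
  · rw [← this]
    simp only [zpow_one, zpow_zero, one_mul]
    congr 2
    push_cast
    field_simp
  · refine Or.inl (Or.inl ⟨by simpa using hw, ?_⟩)
    have : 0 < s := lt_of_lt_of_le (by positivity) hs
    simp only [zpow_one, norm_mul, Complex.norm_real, Real.norm_eq_abs, abs_of_pos this,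
      abs_of_pos h0]
    nlinarith

theorem coeff_eq_of_mem_polydisc {m : ℕ} {g : ℂ × ℂ → ℂ} (hg : DifferentiableOn ℂ g (core m))
    (n k : ℤ)
    {z : ℂ × ℂ} (hz : z ∈ polydisc) (h1 : z.1 ≠ 0) (h2 : z.2 ≠ 0) :
    coeff n k g z = coeff n k g (((1 : ℝ) : ℂ), ((1 : ℝ) : ℂ)) := by
  have he := two_lt_exp_one
  rw [coeff_norm]
  have h3 : coeff n k g ((‖z.1‖ : ℂ), (‖z.2‖ : ℂ)) = coeff n k g (((1 : ℝ) : ℂ), (‖z.2‖ : ℂ)) := by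
    rcases le_total ‖z.1‖ 1 with h | h
    · exact coeff_fst_of_le hg n k (by positivity) h (by linarith) (by simpa using hz.2)
    · exact (coeff_fst_of_le hg n k one_pos h hz.1 (by simpa using hz.2)).symm
  rw [h3]
  have h4 : ‖((1 : ℝ) : ℂ)‖ < Real.exp 1 := by simp
  rcases le_total ‖z.2‖ 1 with h | h
  · exact coeff_snd_of_le hg n k (by positivity) h (by linarith) h4
  · exact (coeff_snd_of_le hg n k one_pos h hz.2 h4).symm

/-- Each horn is pulled back into the bidisc by a scaling that stays in `core m`: direction `(1, 0)`
along the `z₁`-axis and the hyperbolic direction `(-1, 1)` along the `z₂`-axis. -/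
theorem coeff_eq {m : ℕ} {g : ℂ × ℂ → ℂ} (hg : DifferentiableOn ℂ g (core m))
    (n k : ℤ)
    {z : ℂ × ℂ} (hz : z ∈ core m) (h1 : z.1 ≠ 0) (h2 : z.2 ≠ 0) :
    coeff n k g z = coeff n k g (((1 : ℝ) : ℂ), ((1 : ℝ) : ℂ)) := by
  have he := two_lt_exp_one
  rcases hz with (hz | hz) | hz
  · exact coeff_eq_of_mem_polydisc hg n k hz h1 h2
  · obtain ⟨ha, hb, hc⟩ := hz
    have h0 : 0 < ‖z.1‖ := by linarith
    have ht : 0 < 1 / ‖z.1‖ := by positivity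
    have h0' : (‖z.1‖ : ℂ) ≠ 0 := by exact_mod_cast h0.ne'
    have key := coeff_scale (isOpen_core m) (torusInvariant_core m) hg (z := z) n k 1 0
      (t := 1 / ‖z.1‖) ht (by rw [div_le_one h0]; exact ha.le) (fun s hs hs1 => ?_)
    · rw [← key]
      refine coeff_eq_of_mem_polydisc hg n k ⟨?_, by simpa using hb⟩ ?_ (by simpa using h2)
      · simp [h0.ne']
      · simpa using h1
    · have hs0 : 0 < s := ht.trans_le hs
      have hs2 : 1 ≤ s * ‖z.1‖ := by rwa [div_le_iff₀ h0] at hs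
      have hs3 : s * ‖z.1‖ ≤ ‖z.1‖ := by nlinarith
      have hn1 : ‖(s : ℂ) ^ (1 : ℤ) * z.1‖ = s * ‖z.1‖ := by simp [abs_of_pos hs0]
      have hn2 : ‖(s : ℂ) ^ (0 : ℤ) * z.2‖ = ‖z.2‖ := by simp
      -- The endpoint `|z₁| = 1` is outside `hornX` but inside the bidisc. Before it, `r * log r`
      -- increases with `r ≥ 1`, so shrinking `z₁` preserves the horn condition.
      rcases hs2.eq_or_lt with h | h
      · exact Or.inl (Or.inl ⟨by rw [hn1, ← h]; linarith, by rwa [hn2]⟩)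
      · refine Or.inl (Or.inr ⟨by rwa [hn1], by rwa [hn2], ?_⟩)
        rw [hn1, hn2]
        refine lt_of_le_of_lt ?_ hc
        have := Real.log_le_log (by linarith) hs3
        have := Real.log_nonneg h.le
        gcongr
  · obtain ⟨ha, hb, hc⟩ := hz
    rcases lt_or_ge ‖z.2‖ 2 with h | h
    · exact coeff_eq_of_mem_polydisc hg n k ⟨hb, h⟩ h1 h2
    have h0 : 0 < ‖z.2‖ := by linarith
    -- The scaling stops at `|z₂| = 3 / 2`, in the overlap `1 < |z₂| < 2`. There `|z₁| < 2 / (3 / 2)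
    -- < e`, because `|z₁| * |z₂| < 2`.
    have ht : 0 < 3 / 2 / ‖z.2‖ := by positivity
    have hpr : ‖z.1‖ * ‖z.2‖ < 2 := by
      have : 1 ≤ ‖z.2‖ ^ (m - 1) := one_le_pow₀ ha.le
      have h5 := abs_nonneg (‖z.1‖ * ‖z.2‖ - 1)
      have := (abs_lt.1 (show |‖z.1‖ * ‖z.2‖ - 1| < 1 by nlinarith)).2
      linarith
    have hn1 : ∀ s : ℝ, 0 < s → ‖(s : ℂ) ^ (-1 : ℤ) * z.1‖ = ‖z.1‖ / s := by
      intro s hs0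
      rw [div_eq_inv_mul]
      simp [abs_of_pos hs0]
    have hn2 : ∀ s : ℝ, 0 < s → ‖(s : ℂ) ^ (1 : ℤ) * z.2‖ = s * ‖z.2‖ := by
      intro s hs0
      simp [abs_of_pos hs0]
    have hlt : ∀ s : ℝ, 3 / 2 / ‖z.2‖ ≤ s → ‖z.1‖ / s < Real.exp 1 := by
      intro s hs
      have hs0 : 0 < s := ht.trans_le hs
      have hs2 : 3 / 2 ≤ s * ‖z.2‖ := by rwa [div_le_iff₀ h0] at hs
      rw [div_lt_iff₀ hs0]
      have : Real.exp 1 * (3 / 2) ≤ Real.exp 1 * (s * ‖z.2‖) := by gcongr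
      by_contra hcon
      have h6 := mul_le_mul_of_nonneg_right (not_lt.1 hcon) h0.le
      nlinarith
    have key := coeff_scale (isOpen_core m) (torusInvariant_core m) hg (z := z) n k (-1) 1
      (t := 3 / 2 / ‖z.2‖) ht (by rw [div_le_one h0]; linarith) (fun s hs hs1 => ?_)
    · rw [← key]
      have h0' : (‖z.2‖ : ℂ) ≠ 0 := by exact_mod_cast h0.ne'
      refine coeff_eq_of_mem_polydisc hg n k ⟨?_, ?_⟩ ?_ ?_
      · rw [hn1 _ ht]; exact hlt _ le_rfl
      · rw [hn2 _ ht, div_mul_cancel₀ _ h0.ne']; norm_num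
      · simp [h1, h0.ne']
      · simp [h2]
    · have hs0 : 0 < s := ht.trans_le hs
      have hs2 : 3 / 2 ≤ s * ‖z.2‖ := by rwa [div_le_iff₀ h0] at hs
      refine Or.inr ⟨?_, ?_, ?_⟩
      · rw [hn2 s hs0]; linarith
      · rw [hn1 s hs0]; exact hlt s hs
      -- The product of the moduli is unchanged and only the factor `|z₂| ^ (m - 1)` shrinks.
      · rw [hn1 s hs0, hn2 s hs0, show ‖z.1‖ / s * (s * ‖z.2‖) = ‖z.1‖ * ‖z.2‖ by field_simp]
        refine lt_of_le_of_lt ?_ hc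
        have : s * ‖z.2‖ ≤ ‖z.2‖ := by nlinarith
        gcongr

theorem exists_norm_mode_le {m : ℕ} {g : ℂ × ℂ → ℂ} (hg : DifferentiableOn ℂ g (core m))
    (n k : ℤ) :
    ∃ K : ℝ, ∀ z : ℂ × ℂ, ‖z.1‖ ≤ 1 → ‖z.2‖ ≤ 1 →
    ‖mode n k g z‖ ≤ K := by
  have hcpt : IsCompact (closedBall (0 : ℂ × ℂ) 1) := isCompact_closedBall _ _
  have hsub : closedBall (0 : ℂ × ℂ) 1 ⊆ core m := by
    intro z hz
    have he := two_lt_exp_one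
    rw [mem_closedBall_zero_iff, Prod.norm_def, max_le_iff] at hz
    exact Or.inl (Or.inl ⟨by linarith, by linarith⟩)
  obtain ⟨K, hK⟩ := hcpt.exists_bound_of_continuousOn (hg.continuousOn.mono hsub)
  refine ⟨K, fun z h1 h2 => ?_⟩
  have := norm_integral_le_of_norm_le_const (μ := torusMeasure) (C := K)
    (f := fun x => g (rot x z) * chi (-n) (-k) x) (ae_of_all _ fun x => ?_)
  · simpa [mode] using this
  · rw [norm_mul, norm_chi, mul_one]
    apply hK
    rw [mem_closedBall_zero_iff, Prod.norm_def, norm_rot_fst, norm_rot_snd]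
    exact max_le h1 h2

/-- The mode stays bounded on the closed unit bidisc. Letting the coordinate with negative exponent
be `t → 0`, the constant coefficient is at most `K * t`. -/
theorem coeff_eq_zero_of_neg {m : ℕ} {g : ℂ × ℂ → ℂ} (hg : DifferentiableOn ℂ g (core m))
    (n k : ℤ)
    (h : n < 0 ∨ k < 0) :
    coeff n k g (((1 : ℝ) : ℂ), ((1 : ℝ) : ℂ)) = 0 := by
  have he := two_lt_exp_one
  obtain ⟨K, hK⟩ := exists_norm_mode_le hg n k
  have hpow : ∀ (t : ℝ) (j : ℤ), 0 < t → t ≤ 1 → j < 0 → t ^ (-j) ≤ t := by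
    intro t j ht ht1 hj
    calc t ^ (-j) ≤ t ^ (1 : ℤ) := zpow_le_zpow_right_of_le_one₀ ht ht1 (by omega)
      _ = t := zpow_one t
  have hK0 : 0 ≤ K := (norm_nonneg _).trans (hK 0 (by simp) (by simp))
  have key : ∀ t : ℝ, 0 < t → t ≤ 1 →
      ‖coeff n k g (((1 : ℝ) : ℂ), ((1 : ℝ) : ℂ))‖ ≤ K * t := by
    intro t ht ht1
    have htn : ‖(t : ℂ)‖ = t := by simp [abs_of_pos ht]
    rcases h with h | h
    · rw [← coeff_fst_of_le hg n k ht ht1 (by linarith) (by simp), coeff, norm_mul]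
      refine mul_le_mul (hK _ (by rwa [htn]) (by simp)) ?_ (norm_nonneg _) hK0
      rw [norm_mul, norm_zpow, htn]
      simpa using hpow t n ht ht1 h
    · rw [← coeff_snd_of_le hg n k ht ht1 (by linarith) (by simp), coeff, norm_mul]
      refine mul_le_mul (hK _ (by simp) (by rwa [htn])) ?_ (norm_nonneg _) hK0
      rw [norm_mul, norm_zpow, norm_zpow, htn]
      simpa using hpow t k ht ht1 h
  rw [← norm_eq_zero]
  refine le_antisymm ?_ (norm_nonneg _)
  have hlim : Tendsto (fun t : ℝ => K * t) (𝓝[>] 0) (𝓝 (K * 0)) :=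
    (tendsto_const_nhds.mul tendsto_id).mono_left nhdsWithin_le_nhds
  rw [mul_zero] at hlim
  refine ge_of_tendsto hlim ?_
  filter_upwards [Ioc_mem_nhdsGT one_pos] with t ht using key t ht.1 ht.2

/-! ### Square integrability of monomials -/

theorem lintegral_comp_norm {f : ℝ → ℝ≥0∞} (hf : Measurable f) :
    ∫⁻ z : ℂ, f ‖z‖ =
      ENNReal.ofReal (2 * Real.pi) * ∫⁻ r in Set.Ioi 0, ENNReal.ofReal r * f r := by
  rw [← Complex.lintegral_comp_polarCoord_symm, polarCoord_target]
  simp_rw [Complex.norm_polarCoord_symm, smul_eq_mul]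
  rw [Measure.volume_eq_prod, ← Measure.prod_restrict, lintegral_prod _ (by fun_prop)]
  simp only [lintegral_const, Measure.restrict_apply MeasurableSet.univ, Set.univ_inter,
    Real.volume_Ioo]
  rw [lintegral_mul_const _ (by fun_prop), mul_comm]
  congr 1
  · congr 1; ring
  · refine setLIntegral_congr_fun measurableSet_Ioi fun r hr => ?_
    rw [abs_of_pos hr]

theorem enorm_monom_sq (a b : ℕ) (z : ℂ × ℂ) :
    ‖monom a b z‖ₑ ^ 2 = ENNReal.ofReal (‖z.1‖ ^ (2 * a) * ‖z.2‖ ^ (2 * b)) := by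
  rw [← ofReal_norm, ← ENNReal.ofReal_pow (norm_nonneg _), monom, norm_mul, norm_pow, norm_pow]
  congr 1; ring

/-- Polar coordinates in each variable; the two Jacobians turn the exponents `2a` and `2b` into odd
ones. -/
theorem lintegral_monom_region (a b : ℕ) {f g : ℝ → ℝ} (hf : Measurable f) (hg : Measurable g)
    {s : Set ℝ} (hs : MeasurableSet s) (hs0 : s ⊆ Set.Ioi 0) (hf0 : ∀ x ∈ s, 0 ≤ f x) :
    ∫⁻ z in {z : ℂ × ℂ | ‖z.1‖ ∈ s ∧ ‖z.2‖ ∈ Set.Ioo (f ‖z.1‖) (g ‖z.1‖)}, ‖monom a b z‖ₑ ^ 2 =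
      ENNReal.ofReal (2 * Real.pi) ^ 2 * ∫⁻ x in s, ∫⁻ y in Set.Ioo (f x) (g x),
        ENNReal.ofReal (x ^ (2 * a + 1) * y ^ (2 * b + 1)) := by
  set G : ℝ × ℝ → ℝ≥0∞ := (regionBetween f g s).indicator
    (fun p => ENNReal.ofReal (p.1 ^ (2 * a) * p.2 ^ (2 * b))) with hG
  have hGm : Measurable G :=
    Measurable.indicator (by fun_prop) (measurableSet_regionBetween hf hg hs)
  have h1 : ∫⁻ z in {z : ℂ × ℂ | ‖z.1‖ ∈ s ∧ ‖z.2‖ ∈ Set.Ioo (f ‖z.1‖) (g ‖z.1‖)},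
      ‖monom a b z‖ₑ ^ 2 = ∫⁻ z : ℂ × ℂ, G (‖z.1‖, ‖z.2‖) := by
    have hm : MeasurableSet {z : ℂ × ℂ | ‖z.1‖ ∈ s ∧ ‖z.2‖ ∈ Set.Ioo (f ‖z.1‖) (g ‖z.1‖)} :=
      (measurableSet_regionBetween hf hg hs).preimage
        (by fun_prop : Measurable fun z : ℂ × ℂ => (‖z.1‖, ‖z.2‖))
    rw [← lintegral_indicator hm]
    refine lintegral_congr fun z => ?_
    simp only [hG, enorm_monom_sq]
    rfl
  rw [h1, Measure.volume_eq_prod, lintegral_prod _ (by fun_prop)]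
  have h2 : ∀ x : ℝ, ∫⁻ w : ℂ, G (x, ‖w‖) =
      ENNReal.ofReal (2 * Real.pi) * ∫⁻ y in Set.Ioi 0, ENNReal.ofReal y * G (x, y) := fun x =>
    lintegral_comp_norm (f := fun y => G (x, y)) (by fun_prop)
  simp only [h2]
  rw [lintegral_comp_norm (f := fun x => ENNReal.ofReal (2 * Real.pi) *
    ∫⁻ y in Set.Ioi 0, ENNReal.ofReal y * G (x, y))]
  · simp_rw [mul_left_comm (ENNReal.ofReal _) (ENNReal.ofReal (2 * Real.pi))]
    rw [lintegral_const_mul' _ _ ENNReal.ofReal_ne_top, ← mul_assoc, ← sq]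
    congr 1
    rw [← Set.inter_eq_self_of_subset_left hs0, ← setLIntegral_indicator hs]
    refine setLIntegral_congr_fun measurableSet_Ioi fun x (hx : 0 < x) => ?_
    by_cases hxs : x ∈ s
    · simp only [Set.indicator_of_mem hxs]
      rw [← lintegral_const_mul' _ _ ENNReal.ofReal_ne_top]
      have hsub : Set.Ioo (f x) (g x) ⊆ Set.Ioi 0 := fun y hy => (hf0 x hxs).trans_lt hy.1
      rw [← Set.inter_eq_self_of_subset_left hsub, ← setLIntegral_indicator measurableSet_Ioo]
      refine setLIntegral_congr_fun measurableSet_Ioi fun y (hy : 0 < y) => ?_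
      by_cases hyI : y ∈ Set.Ioo (f x) (g x)
      · have : (x, y) ∈ regionBetween f g s := ⟨hxs, hyI⟩
        simp only [hG, Set.indicator_of_mem hyI, Set.indicator_of_mem this]
        rw [← ENNReal.ofReal_mul hy.le, ← ENNReal.ofReal_mul hx.le]
        congr 1; ring
      · have : (x, y) ∉ regionBetween f g s := fun h => hyI h.2
        simp only [hG, Set.indicator_of_notMem hyI, Set.indicator_of_notMem this, mul_zero]
    · simp only [Set.indicator_of_notMem hxs]
      have : ∀ y, G (x, y) = 0 := fun y => Set.indicator_of_notMem (fun h => hxs h.1) _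
      simp [this]
  · exact Measurable.const_mul (Measurable.lintegral_prod_right' (f := fun p : ℝ × ℝ =>
      ENNReal.ofReal p.2 * G p) (by fun_prop)) _

theorem lintegral_Ioo_pow_le {c u v : ℝ} (hc : 0 ≤ c) (hu : 0 ≤ u) (huv : u ≤ v) (n : ℕ) :
    ∫⁻ y in Set.Ioo u v, ENNReal.ofReal (c * y ^ n) ≤ ENNReal.ofReal (c * v ^ n * (v - u)) := by
  calc _ ≤ ∫⁻ _ in Set.Ioo u v, ENNReal.ofReal (c * v ^ n) := by
        refine setLIntegral_mono' measurableSet_Ioo fun y hy => ENNReal.ofReal_le_ofReal ?_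
        have := hu.trans hy.1.le
        have := hy.2.le
        gcongr
    _ = _ := by
        rw [setLIntegral_const, Real.volume_Ioo, ← ENNReal.ofReal_mul]
        have := hu.trans huv
        positivity

theorem le_lintegral_Ioo_pow {c u u' v : ℝ} (hc : 0 ≤ c) (hu : u ≤ u') (hu' : 0 ≤ u') (n : ℕ) :
    ENNReal.ofReal (c * u' ^ n * (v - u')) ≤ ∫⁻ y in Set.Ioo u v, ENNReal.ofReal (c * y ^ n) := by
  calc _ = ∫⁻ _ in Set.Ioo u' v, ENNReal.ofReal (c * u' ^ n) := by
        rw [setLIntegral_const, Real.volume_Ioo, ← ENNReal.ofReal_mul (by positivity)]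
    _ ≤ ∫⁻ y in Set.Ioo u' v, ENNReal.ofReal (c * y ^ n) := by
        refine setLIntegral_mono' measurableSet_Ioo fun y hy => ENNReal.ofReal_le_ofReal ?_
        have := hy.1.le
        gcongr
    _ ≤ _ := lintegral_mono_set (Set.Ioo_subset_Ioo_left hu)

theorem X_ae_eq : X =ᵐ[volume] {z : ℂ × ℂ | ‖z.1‖ ∈ Set.Ioi (Real.exp 1) ∧
    ‖z.2‖ ∈ Set.Ioo 0 (1 / (‖z.1‖ * Real.log ‖z.1‖))} := by
  filter_upwards [ae_ne_zero] with z hz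
  refine propext ⟨fun h => ⟨h.1, norm_pos_iff.2 hz.2, h.2⟩, fun h => ⟨h.1, h.2.2⟩⟩

theorem lintegral_X (a b : ℕ) : ∫⁻ z in X, ‖monom a b z‖ₑ ^ 2 =
    ENNReal.ofReal (2 * Real.pi) ^ 2 * ∫⁻ x in Set.Ioi (Real.exp 1),
      ∫⁻ y in Set.Ioo 0 (1 / (x * Real.log x)),
        ENNReal.ofReal (x ^ (2 * a + 1) * y ^ (2 * b + 1)) := by
  rw [setLIntegral_congr X_ae_eq]
  exact lintegral_monom_region a b (f := fun _ => 0) (g := fun x => 1 / (x * Real.log x))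
    (by fun_prop) (by fun_prop) measurableSet_Ioi
    (Set.Ioi_subset_Ioi (Real.exp_pos 1).le) (fun _ _ => le_rfl)

theorem one_lt_log {x : ℝ} (hx : Real.exp 1 < x) : 1 < Real.log x := by
  rw [← Real.log_exp 1]; exact Real.log_lt_log (Real.exp_pos 1) hx

theorem ofReal_two_pi_sq_ne_zero : ENNReal.ofReal (2 * Real.pi) ^ 2 ≠ 0 :=
  pow_ne_zero 2 (by simp [Real.pi_pos])

theorem ofReal_two_pi_sq_ne_top : ENNReal.ofReal (2 * Real.pi) ^ 2 ≠ ∞ :=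
  ENNReal.pow_ne_top ENNReal.ofReal_ne_top

/-- The inner integral is at most `x ^ (2a - 2b - 1) / (log x) ^ (2b + 2)`, which is dominated by
the integrable `1 / (x * (log x) ^ 2)`; the logarithm is what admits `a = b`. -/
theorem lintegral_X_lt_top {a b : ℕ} (hab : a ≤ b) : ∫⁻ z in X, ‖monom a b z‖ₑ ^ 2 < ∞ := by
  rw [lintegral_X]
  refine ENNReal.mul_lt_top ofReal_two_pi_sq_ne_top.lt_top ?_
  have hint := integrableOn_inv_div_log_sq_Ioi (c := Real.exp 1) (by
    have := two_lt_exp_one; linarith)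
  refine lt_of_le_of_lt ?_ hint.lintegral_lt_top
  refine setLIntegral_mono' measurableSet_Ioi fun x hx => ?_
  have hx0 : 1 < x := by have := two_lt_exp_one; have : Real.exp 1 < x := hx; linarith
  have hl := one_lt_log hx
  refine (lintegral_Ioo_pow_le (by positivity) le_rfl (by positivity) _).trans
    (ENNReal.ofReal_le_ofReal ?_)
  obtain ⟨d, rfl⟩ := Nat.exists_eq_add_of_le hab
  set l := Real.log x
  have h1 : x ^ (2 * a + 1) * (1 / (x * l)) ^ (2 * (a + d) + 1) * (1 / (x * l) - 0) =
      x⁻¹ / l ^ 2 * (1 / (x ^ (2 * d) * l ^ (2 * (a + d)))) := by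
    rw [sub_zero, mul_assoc, ← pow_succ, div_pow, one_pow, mul_pow]
    field_simp
    ring
  rw [h1]
  refine mul_le_of_le_one_right (by positivity) ?_
  rw [div_le_one (by positivity)]
  exact one_le_mul_of_one_le_of_one_le (one_le_pow₀ hx0.le) (one_le_pow₀ hl.le)

/-- As soon as `a ≥ b + 1`, the power of `x` is at least one and beats every power of the logarithm,
so the inner integral is bounded below on a half-line. -/
theorem lintegral_X_eq_top {a b : ℕ} (hab : b < a) : ∫⁻ z in X, ‖monom a b z‖ₑ ^ 2 = ∞ := by
  rw [lintegral_X, ENNReal.mul_eq_top]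
  refine Or.inl ⟨ofReal_two_pi_sq_ne_zero, ?_⟩
  have hlo := (Real.isLittleO_pow_log_id_atTop (n := 2 * b + 2)).bound one_pos
  obtain ⟨x₀, hx₀⟩ := eventually_atTop.1 hlo
  set x₁ := max x₀ (Real.exp 1) with hx₁
  rw [eq_top_iff]
  calc (∞ : ℝ≥0∞) = ∫⁻ _ in Set.Ioi x₁, ENNReal.ofReal ((1 / 2) ^ (2 * b + 2)) := by
        rw [setLIntegral_const, Real.volume_Ioi, ENNReal.mul_top]
        simp
    _ ≤ ∫⁻ x in Set.Ioi x₁, ∫⁻ y in Set.Ioo 0 (1 / (x * Real.log x)),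
        ENNReal.ofReal (x ^ (2 * a + 1) * y ^ (2 * b + 1)) := by
        refine setLIntegral_mono' measurableSet_Ioi fun x (hx : x₁ < x) => ?_
        have hxe : Real.exp 1 < x := (le_max_right _ _).trans_lt hx
        have hx0 : 1 < x := by have := two_lt_exp_one; linarith
        have hl := one_lt_log hxe
        have hb := hx₀ x ((le_max_left _ _).trans hx.le)
        set l := Real.log x
        -- Only the upper half of the `y`-interval is kept, where `y` is comparable to `1 / (x * log
        -- x)`.
        refine le_trans (ENNReal.ofReal_le_ofReal ?_)
          (le_lintegral_Ioo_pow (u' := 1 / (x * l) / 2) (by positivity) (by positivity)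
            (by positivity) _)
        rw [id, one_mul, Real.norm_of_nonneg (by positivity), Real.norm_of_nonneg (by positivity)]
          at hb
        obtain ⟨d, rfl⟩ := Nat.exists_eq_add_of_le hab
        have h1 : x ^ (2 * (b + 1 + d) + 1) * (1 / (x * l) / 2) ^ (2 * b + 1) *
            (1 / (x * l) - 1 / (x * l) / 2) =
            (1 / 2) ^ (2 * b + 2) * (x ^ (2 * d) * (x / l ^ (2 * b + 2))) := by
          rw [show 1 / (x * l) - 1 / (x * l) / 2 = 1 / (x * l) / 2 by ring, mul_assoc, ← pow_succ,
            div_pow, div_pow, div_pow, mul_pow]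
          field_simp
          ring
        rw [h1]
        refine le_mul_of_one_le_right (by positivity) ?_
        refine one_le_mul_of_one_le_of_one_le (one_le_pow₀ hx0.le) ?_
        rwa [one_le_div (by positivity)]
    _ ≤ _ := lintegral_mono_set (Set.Ioi_subset_Ioi (le_max_right _ _))

/-- `Y m` is fibred over `|z₂|`, so the coordinates are swapped before the region formula is used.
-/
theorem lintegral_Y {m : ℕ} (hm : 1 ≤ m) (a b : ℕ) : ∫⁻ z in Y m, ‖monom a b z‖ₑ ^ 2 =
    ENNReal.ofReal (2 * Real.pi) ^ 2 * ∫⁻ x in Set.Ioi 2,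
      ∫⁻ y in Set.Ioo (1 / x - 1 / x ^ m) (1 / x + 1 / x ^ m),
        ENNReal.ofReal (x ^ (2 * b + 1) * y ^ (2 * a + 1)) := by
  have h1 := lintegral_monom_region b a (f := fun x => 1 / x - 1 / x ^ m)
    (g := fun x => 1 / x + 1 / x ^ m) (s := Set.Ioi 2)
    (by fun_prop) (by fun_prop) measurableSet_Ioi
    (Set.Ioi_subset_Ioi zero_le_two) (fun x (hx : 2 < x) => by
      rw [sub_nonneg]
      refine one_div_le_one_div_of_le (by linarith) ?_
      exact le_self_pow₀ (by linarith) (by omega))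
  rw [← h1]
  have hsw : MeasurePreserving (Prod.swap : ℂ × ℂ → ℂ × ℂ) volume volume :=
    Measure.measurePreserving_swap
  have hemb : MeasurableEmbedding (Prod.swap : ℂ × ℂ → ℂ × ℂ) :=
    (MeasurableEquiv.prodComm : (ℂ × ℂ) ≃ᵐ (ℂ × ℂ)).measurableEmbedding
  rw [← hsw.setLIntegral_comp_preimage_emb hemb]
  have hset : Prod.swap ⁻¹' Y m = {z : ℂ × ℂ | ‖z.1‖ ∈ Set.Ioi 2 ∧
      ‖z.2‖ ∈ Set.Ioo (1 / ‖z.1‖ - 1 / ‖z.1‖ ^ m) (1 / ‖z.1‖ + 1 / ‖z.1‖ ^ m)} := by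
    ext z
    simp only [Y, Set.mem_preimage, Set.mem_ofPred_eq, Prod.fst_swap, Prod.snd_swap, Set.mem_Ioi,
      Set.mem_Ioo, abs_lt]
    refine and_congr_right fun _ => ?_
    constructor <;> rintro ⟨h1, h2⟩ <;> constructor <;> linarith
  rw [hset]
  refine lintegral_congr fun z => ?_
  simp [monom, mul_comm]

theorem half_le_sub {m : ℕ} (hm : 2 ≤ m) {x : ℝ} (hx : 2 < x) :
    1 / x / 2 ≤ 1 / x - 1 / x ^ m := by
  obtain ⟨k, rfl⟩ : ∃ k, m = k + 2 := ⟨m - 2, by omega⟩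
  have h2 : 1 / x ^ (k + 2) ≤ 1 / x / 2 := by
    rw [div_div]
    refine one_div_le_one_div_of_le (by linarith) ?_
    have : 1 ≤ x ^ k := one_le_pow₀ (by linarith)
    have h3 : x * 2 ≤ x * x := by nlinarith
    calc x * 2 ≤ x * x := h3
      _ ≤ x ^ k * (x * x) := le_mul_of_one_le_left (by nlinarith) this
      _ = x ^ (k + 2) := by ring
  linarith

theorem rpow_eq_div {x : ℝ} (hx : 0 < x) (a b m : ℕ) :
    x ^ ((2 * b : ℝ) - 2 * a - m) = x ^ (2 * b) / (x ^ (2 * a) * x ^ m) := by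
  rw [sub_sub, Real.rpow_sub hx, Real.rpow_add hx]
  congr 1
  · rw [← Real.rpow_natCast]; push_cast; rfl
  · rw [← Real.rpow_natCast, ← Real.rpow_natCast]; push_cast; rfl

/-- On the fibre over `x`, `y` lies between `1 / (2x)` and `2 / x`, and the fibre has length `2 / x
^ m`. The inner integral is therefore comparable to `x ^ (2b - 2a - m)`, integrable at infinity
exactly when the exponent is below `-1`. -/
theorem lintegral_Y_lt_top_iff {m : ℕ} (hm : 2 ≤ m) (a b : ℕ) :
    ∫⁻ z in Y m, ‖monom a b z‖ₑ ^ 2 < ∞ ↔ (b : ℝ) - ((m : ℝ) - 1) / 2 < a := by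
  have hiff := integrableOn_Ioi_rpow_iff (s := (2 * b : ℝ) - 2 * a - m) (t := 2) two_pos
  have hiff' : IntegrableOn (fun x : ℝ => x ^ ((2 * b : ℝ) - 2 * a - m)) (Set.Ioi 2) ↔
      ∫⁻ x in Set.Ioi (2 : ℝ), ENNReal.ofReal (x ^ ((2 * b : ℝ) - 2 * a - m)) < ∞ := by
    rw [IntegrableOn, ← hasFiniteIntegral_iff_ofReal]
    · refine ⟨fun h => h.2, fun h => ⟨?_, h⟩⟩
      exact (by fun_prop : Measurable _).aestronglyMeasurable
    · filter_upwards [ae_restrict_mem measurableSet_Ioi] with x hx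
      have : (2 : ℝ) < x := hx
      positivity
  have hcond : (b : ℝ) - ((m : ℝ) - 1) / 2 < a ↔ (2 * b : ℝ) - 2 * a - m < -1 := by
    constructor <;> intro h <;> linarith
  rw [hcond, ← hiff, hiff', lintegral_Y (by omega)]
  constructor
  · intro h
    have h1 := (ENNReal.mul_lt_top_iff.1 h)
    have h2 : ∫⁻ x in Set.Ioi (2 : ℝ), ENNReal.ofReal ((1 / 2) ^ (2 * a)) *
        ENNReal.ofReal (x ^ ((2 * b : ℝ) - 2 * a - m)) ≤ ∫⁻ x in Set.Ioi 2,
      ∫⁻ y in Set.Ioo (1 / x - 1 / x ^ m) (1 / x + 1 / x ^ m),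
        ENNReal.ofReal (x ^ (2 * b + 1) * y ^ (2 * a + 1)) := by
      refine setLIntegral_mono' measurableSet_Ioi fun x (hx : 2 < x) => ?_
      have hx0 : 0 < x := by linarith
      have h3 := half_le_sub hm hx
      rw [← ENNReal.ofReal_mul (by positivity), rpow_eq_div hx0]
      refine le_trans (ENNReal.ofReal_le_ofReal ?_)
        (le_lintegral_Ioo_pow (by positivity) le_rfl (le_trans (by positivity) h3) _)
      calc (1 / 2) ^ (2 * a) * (x ^ (2 * b) / (x ^ (2 * a) * x ^ m))
          = x ^ (2 * b + 1) * (1 / x / 2) ^ (2 * a + 1) *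
            (1 / x + 1 / x ^ m - (1 / x - 1 / x ^ m)) := by
            rw [div_pow, div_pow, div_pow]; field_simp; ring
        _ ≤ _ := by
            refine mul_le_mul_of_nonneg_right (by gcongr) ?_
            rw [show 1 / x + 1 / x ^ m - (1 / x - 1 / x ^ m) = 2 * (1 / x ^ m) by ring]
            positivity
    have h3 : ∫⁻ x in Set.Ioi 2, ∫⁻ y in Set.Ioo (1 / x - 1 / x ^ m) (1 / x + 1 / x ^ m),
        ENNReal.ofReal (x ^ (2 * b + 1) * y ^ (2 * a + 1)) < ∞ := by
      rcases h1 with h1 | h1 | h1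
      · exact h1.2
      · exact absurd h1 ofReal_two_pi_sq_ne_zero
      · rw [h1]; simp
    rw [lintegral_const_mul' _ _ ENNReal.ofReal_ne_top] at h2
    rcases ENNReal.mul_lt_top_iff.1 (h2.trans_lt h3) with h4 | h4 | h4
    · exact h4.2
    · exact absurd h4 (by simp)
    · rw [h4]; simp
  · intro h
    refine ENNReal.mul_lt_top ofReal_two_pi_sq_ne_top.lt_top ?_
    refine lt_of_le_of_lt ?_ (ENNReal.mul_lt_top (a := ENNReal.ofReal (2 * 2 ^ (2 * a + 1)))
      ENNReal.ofReal_lt_top h)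
    rw [← lintegral_const_mul' _ _ ENNReal.ofReal_ne_top]
    refine setLIntegral_mono' measurableSet_Ioi fun x (hx : 2 < x) => ?_
    have hx0 : 0 < x := by linarith
    have h3 := half_le_sub hm hx
    have h4 : 0 < 1 / x := by positivity
    have h5 : 0 < 1 / x ^ m := by positivity
    rw [← ENNReal.ofReal_mul (by positivity), rpow_eq_div hx0]
    refine (lintegral_Ioo_pow_le (by positivity) (by linarith) (by linarith) _).trans
      (ENNReal.ofReal_le_ofReal ?_)
    calc x ^ (2 * b + 1) * (1 / x + 1 / x ^ m) ^ (2 * a + 1) *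
            (1 / x + 1 / x ^ m - (1 / x - 1 / x ^ m))
        ≤ x ^ (2 * b + 1) * (2 / x) ^ (2 * a + 1) *
            (1 / x + 1 / x ^ m - (1 / x - 1 / x ^ m)) := by
          refine mul_le_mul_of_nonneg_right ?_ (by linarith)
          have : 1 / x + 1 / x ^ m ≤ 2 / x := by
            rw [show 2 / x = 1 / x + 1 / x by ring]; linarith
          gcongr
      _ = _ := by rw [div_pow]; field_simp; ring

theorem lintegral_Z_lt_top (a b : ℕ) : ∫⁻ z in Z, ‖monom a b z‖ₑ ^ 2 < ∞ := by
  have hsub : Z ⊆ closedBall (0 : ℂ × ℂ) (max (Real.exp 1) 2) := by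
    intro z hz
    rw [mem_closedBall_zero_iff, Prod.norm_def]
    exact max_le_max hz.1 hz.2
  refine (lintegral_mono_set hsub).trans_lt ?_
  have hc : Continuous fun z : ℂ × ℂ => ‖monom a b z‖₊ ^ 2 := by
    unfold monom; fun_prop
  have hcpt := isCompact_closedBall (0 : ℂ × ℂ) (max (Real.exp 1) 2)
  have := isAddHaarMeasure_volume
  simpa [enorm_eq_nnnorm] using
    setLIntegral_lt_top_of_isCompact hcpt.measure_lt_top.ne hcpt hc

theorem lintegral_core_lt_top_iff {m : ℕ} (hm : 2 ≤ m) (a b : ℕ) :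
    ∫⁻ z in core m, ‖monom a b z‖ₑ ^ 2 < ∞ ↔ (a, b) ∈ R m := by
  have hsubX : X ⊆ core m := fun z hz => Or.inl (Or.inr (X_subset_hornX hz))
  have hsubY : Y m ⊆ core m := fun z hz => Or.inr (Y_subset_hornY (by omega) hz)
  have hY := lintegral_Y_lt_top_iff hm a b
  constructor
  · intro h
    refine ⟨?_, hY.1 ((lintegral_mono_set hsubY).trans_lt h)⟩
    by_contra hab
    have h1 := (lintegral_mono_set hsubX).trans_lt h
    rw [lintegral_X_eq_top (not_le.1 hab)] at h1
    exact lt_irrefl _ h1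
  · rintro ⟨h1, h2⟩
    refine (lintegral_mono_set (core_subset (by omega))).trans_lt ?_
    refine (lintegral_union_le _ _ _).trans_lt (ENNReal.add_lt_top.2 ⟨?_, lintegral_Z_lt_top a b⟩)
    exact (lintegral_union_le _ _ _).trans_lt
      (ENNReal.add_lt_top.2 ⟨lintegral_X_lt_top h1, hY.2 h2⟩)

/-! ### Torus averages in L² and completeness of the monomials -/

theorem continuous_rot_apply (x : Torus) : Continuous (rot x) :=
  continuous_rot.comp (by fun_prop : Continuous fun z : ℂ × ℂ => (x, z))

theorem measurePreserving_rot (x : Torus) : MeasurePreserving (rot x) volume volume := by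
  have h : ∀ u : AddCircle (2 * Real.pi),
      MeasurePreserving (fun w : ℂ => fourier 1 u * w) volume volume := fun u => by
    rw [fourier_one]
    exact (rotation (toCircle u)).measurePreserving
  exact (h x.1).prod (h x.2)

theorem rot_neg_rot (x : Torus) (z : ℂ × ℂ) : rot (-x) (rot x z) = z := by
  rw [← rot_add, neg_add_cancel, rot_zero]

theorem rot_rot_neg (x : Torus) (z : ℂ × ℂ) : rot x (rot (-x) z) = z := by
  rw [← rot_add, add_neg_cancel, rot_zero]

/-- The action of an element of the torus, as a homeomorphism. -/
def rotHomeomorph (x : Torus) : (ℂ × ℂ) ≃ₜ (ℂ × ℂ) where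
  toFun := rot x
  invFun := rot (-x)
  left_inv := rot_neg_rot x
  right_inv := rot_rot_neg x
  continuous_toFun := continuous_rot_apply x
  continuous_invFun := continuous_rot_apply (-x)

theorem measurableEmbedding_rot (x : Torus) : MeasurableEmbedding (rot x) :=
  (rotHomeomorph x).measurableEmbedding

theorem TorusInvariant.rot_mem_iff {U : Set (ℂ × ℂ)} (hU : TorusInvariant U) (x : Torus)
    (z : ℂ × ℂ) : rot x z ∈ U ↔ z ∈ U :=
  ⟨fun h => rot_neg_rot x z ▸ hU (-x) _ h, hU x z⟩

theorem TorusInvariant.setIntegral_comp_rot {U : Set (ℂ × ℂ)} (hU : TorusInvariant U)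
    (F : ℂ × ℂ → ℂ) (x : Torus) : ∫ z in U, F (rot x z) = ∫ z in U, F z := by
  rw [← (measurePreserving_rot x).setIntegral_preimage_emb (measurableEmbedding_rot x) F U]
  congr 2
  ext z
  exact (hU.rot_mem_iff x z).symm

theorem exists_chi_ne_one {n k : ℤ} (h : n ≠ 0 ∨ k ≠ 0) : ∃ x, chi n k x ≠ 1 := by
  have key : ∀ j : ℤ, j ≠ 0 → ∃ u : AddCircle (2 * Real.pi), fourier j u ≠ 1 := by
    intro j hj
    refine ⟨((Real.pi / j : ℝ) : AddCircle (2 * Real.pi)), ?_⟩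
    have hj' : (j : ℂ) ≠ 0 := by exact_mod_cast hj
    have hp : (Real.pi : ℂ) ≠ 0 := by exact_mod_cast Real.pi_ne_zero
    rw [fourier_coe_apply, show 2 * (Real.pi : ℂ) * Complex.I * j * ((Real.pi / j : ℝ) : ℂ) /
      ((2 * Real.pi : ℝ) : ℂ) = Real.pi * Complex.I by push_cast; field_simp, Complex.exp_pi_mul_I]
    norm_num
  rcases h with h | h
  · obtain ⟨u, hu⟩ := key n h
    exact ⟨(u, 0), by simpa only [chi, fourier_eval_zero, mul_one] using hu⟩
  · obtain ⟨u, hu⟩ := key k h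
    exact ⟨(0, u), by simpa only [chi, fourier_eval_zero, one_mul] using hu⟩

/-- A rotation multiplies the integral by a character value different from one, yet leaves it
unchanged. This yields all orthogonality relations below. -/
theorem TorusInvariant.setIntegral_eq_zero {U : Set (ℂ × ℂ)} (hU : TorusInvariant U)
    {F : ℂ × ℂ → ℂ} {n k : ℤ} (h : n ≠ 0 ∨ k ≠ 0)
    (hF : ∀ x z, F (rot x z) = chi n k x * F z) : ∫ z in U, F z = 0 := by
  obtain ⟨x, hx⟩ := exists_chi_ne_one h
  have h1 := hU.setIntegral_comp_rot F x
  simp only [hF] at h1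
  rw [integral_const_mul] at h1
  have h2 : (chi n k x - 1) * ∫ z in U, F z = 0 := by rw [sub_mul, h1, one_mul, sub_self]
  exact (mul_eq_zero.1 h2).resolve_left (sub_ne_zero.2 hx)

theorem monom_rot (a b : ℕ) (x : Torus) (z : ℂ × ℂ) :
    monom a b (rot x z) = chi a b x * monom a b z := by
  rw [monom, monom, chi, fourier_eq_zpow a, fourier_eq_zpow b, zpow_natCast, zpow_natCast, rot,
    mul_pow, mul_pow]
  ring

theorem conj_chi (n k : ℤ) (x : Torus) : conj (chi n k x) = chi (-n) (-k) x := by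
  simp only [chi, map_mul, fourier_neg]

theorem sq_lintegral_le_lintegral_sq {α : Type*} [MeasurableSpace α] (μ : Measure α)
    [IsProbabilityMeasure μ] {f : α → ℂ} (hf : AEStronglyMeasurable f μ) :
    (∫⁻ x, ‖f x‖ₑ ∂μ) ^ 2 ≤ ∫⁻ x, ‖f x‖ₑ ^ 2 ∂μ := by
  have h := eLpNorm_le_eLpNorm_of_exponent_le (one_le_two : (1 : ℝ≥0∞) ≤ 2) hf
  rw [eLpNorm_one_eq_lintegral_enorm,
    eLpNorm_eq_lintegral_rpow_enorm_toReal (by simp) (by simp)] at h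
  simp only [ENNReal.toReal_ofNat, ENNReal.rpow_ofNat] at h
  refine (pow_le_pow_left' h 2).trans_eq ?_
  rw [← ENNReal.rpow_natCast, ← ENNReal.rpow_mul]
  norm_num

/-- A mode is an average, over a probability measure, of rotated copies of `G` with unimodular
weights; Cauchy–Schwarz and Tonelli give the contraction. -/
theorem lintegral_mode_sq_le (n k : ℤ) {G : ℂ × ℂ → ℂ} (hG : Measurable G) :
    ∫⁻ z, ‖mode n k G z‖ₑ ^ 2 ≤ ∫⁻ z, ‖G z‖ₑ ^ 2 := by
  have hrot := continuous_rot.measurable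
  have hmz : ∀ z, Measurable fun x : Torus => G (rot x z) := fun z =>
    hG.comp (hrot.comp (by fun_prop : Measurable fun x : Torus => (x, z)))
  calc ∫⁻ z, ‖mode n k G z‖ₑ ^ 2
      ≤ ∫⁻ z, ∫⁻ x, ‖G (rot x z)‖ₑ ^ 2 ∂torusMeasure := by
        refine lintegral_mono fun z => ?_
        refine le_trans ?_ (sq_lintegral_le_lintegral_sq torusMeasure (hmz z).aestronglyMeasurable)
        refine pow_le_pow_left' ((enorm_integral_le_lintegral_enorm _).trans_eq ?_) 2
        refine lintegral_congr fun x => ?_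
        rw [enorm_mul, ← ofReal_norm (chi _ _ x), norm_chi, ENNReal.ofReal_one, mul_one]
    _ = ∫⁻ x, (∫⁻ z, ‖G (rot x z)‖ₑ ^ 2) ∂torusMeasure := by
        refine lintegral_lintegral_swap (Measurable.aemeasurable ?_)
        exact ((hG.comp (hrot.comp measurable_swap)).enorm).pow_const 2
    _ = ∫⁻ _ : Torus, (∫⁻ z, ‖G z‖ₑ ^ 2) ∂torusMeasure := by
        refine lintegral_congr fun x => ?_
        exact (measurePreserving_rot x).lintegral_comp_emb (measurableEmbedding_rot x)
          fun z => ‖G z‖ₑ ^ 2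
    _ = ∫⁻ z, ‖G z‖ₑ ^ 2 := by simp

/-- The monomial has the same torus weight as the mode, so pairing with it sees only that mode. -/
theorem integral_conj_monom_mul_mode (a b : ℕ) {G : ℂ × ℂ → ℂ}
    (hi : Integrable fun z => conj (monom a b z) * G z) :
    ∫ z, conj (monom a b z) * mode a b G z = ∫ z, conj (monom a b z) * G z := by
  set H : ℂ × ℂ → ℂ := fun z => conj (monom a b z) * G z with hH
  have h1 : ∀ z, conj (monom a b z) * mode a b G z = ∫ x, H (rot x z) ∂torusMeasure := by
    intro z
    rw [mode, ← integral_const_mul]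
    refine integral_congr_ae (ae_of_all _ fun x => ?_)
    simp only [hH]
    rw [monom_rot, map_mul, conj_chi]
    ring
  -- This shear preserves the product measure, which transfers integrability of `H` to the integrand
  -- needed for Fubini.
  have hskew : MeasurePreserving (fun p : Torus × (ℂ × ℂ) => (p.1, rot p.1 p.2))
      (torusMeasure.prod volume) (torusMeasure.prod volume) :=
    (MeasurePreserving.id torusMeasure).skew_product (g := rot) continuous_rot.measurable
      (ae_of_all _ fun x => (measurePreserving_rot x).map_eq)
  have hint : Integrable (fun p : Torus × (ℂ × ℂ) => H (rot p.1 p.2))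
      (torusMeasure.prod volume) :=
    hskew.integrable_comp_of_integrable (hi.comp_snd torusMeasure)
  simp_rw [h1]
  rw [← integral_integral_swap (f := fun x z => H (rot x z)) hint]
  have h2 : ∀ x : Torus, ∫ z, H (rot x z) = ∫ z, H z := fun x =>
    (measurePreserving_rot x).integral_comp (measurableEmbedding_rot x) H
  simp only [h2]
  simp

theorem measurable_indicator_of_continuousOn {U : Set (ℂ × ℂ)} (hU : IsOpen U) {g : ℂ × ℂ → ℂ}
    (hg : ContinuousOn g U) : Measurable (U.indicator g) := by
  classical
  rw [← Set.piecewise_eq_indicator]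
  exact hg.measurable_piecewise continuousOn_const hU.measurableSet

theorem continuous_monom (a b : ℕ) : Continuous (monom a b) := by
  unfold monom; fun_prop

theorem lintegral_monom_pos (m a b : ℕ) : 0 < ∫⁻ z in core m, ‖monom a b z‖ₑ ^ 2 := by
  have := isAddHaarMeasure_volume
  rw [pos_iff_ne_zero]
  intro h0
  rw [lintegral_eq_zero_iff (by have := continuous_monom a b; fun_prop)] at h0
  have h1 : ∀ᵐ z ∂volume.restrict (core m), False := by
    filter_upwards [h0, ae_restrict_of_ae ae_ne_zero] with z hz h2
    have : monom a b z ≠ 0 := mul_ne_zero (pow_ne_zero _ h2.1) (pow_ne_zero _ h2.2)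
    simp [this] at hz
  rw [eventually_false_iff_eq_bot, ae_eq_bot, Measure.restrict_eq_zero] at h1
  refine ((isOpen_core m).measure_pos volume ⟨0, Or.inl (Or.inl ⟨?_, ?_⟩)⟩).ne' h1
  · simpa using Real.exp_pos 1
  · simp

theorem memLp_two_iff {U : Set (ℂ × ℂ)} {g : ℂ × ℂ → ℂ}
    (hg : AEStronglyMeasurable g (volume.restrict U)) :
    MemLp g 2 (volume.restrict U) ↔ ∫⁻ z in U, ‖g z‖ₑ ^ 2 < ∞ := by
  rw [MemLp, and_iff_right hg, eLpNorm_lt_top_iff_lintegral_rpow_enorm_lt_top (by simp) (by simp)]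
  simp

theorem memLp_monom_iff {m : ℕ} (hm : 2 ≤ m) (a b : ℕ) :
    MemLp (monom a b) 2 (volume.restrict (core m)) ↔ (a, b) ∈ R m := by
  rw [memLp_two_iff (continuous_monom a b).aestronglyMeasurable, lintegral_core_lt_top_iff hm]

theorem integral_norm_monom_sq_pos {m : ℕ} (hm : 2 ≤ m) {a b : ℕ} (h : (a, b) ∈ R m) :
    0 < ∫ z in core m, ‖monom a b z‖ ^ 2 := by
  have h1 : ∫ z in core m, ‖monom a b z‖ ^ 2 =
      (∫⁻ z in core m, ‖monom a b z‖ₑ ^ 2).toReal := by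
    rw [integral_eq_lintegral_of_nonneg_ae (ae_of_all _ fun z => by positivity)
      (by have := continuous_monom a b; fun_prop)]
    congr 1
    refine lintegral_congr fun z => ?_
    rw [ENNReal.ofReal_pow (norm_nonneg _), ofReal_norm]
  rw [h1]
  exact ENNReal.toReal_pos (lintegral_monom_pos m a b).ne'
    ((lintegral_core_lt_top_iff hm a b).2 h).ne

/-- A square integrable holomorphic function that is orthogonal to all square integrable monomials
vanishes. -/
theorem eq_zero_of_orthogonal_monom {m : ℕ} (hm : 2 ≤ m) {g : ℂ × ℂ → ℂ}
    (hg : DifferentiableOn ℂ g (core m)) (hL : MemLp g 2 (volume.restrict (core m)))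
    (horth : ∀ a b, (a, b) ∈ R m → ∫ z in core m, conj (monom a b z) * g z = 0)
    {z : ℂ × ℂ} (hz : z ∈ core m) (hz1 : z.1 ≠ 0) (hz2 : z.2 ≠ 0) : g z = 0 := by
  have hinv := torusInvariant_core m
  have hms := (isOpen_core m).measurableSet
  -- Extension by zero commutes with taking modes, so the whole-space lemmas apply.
  set G := (core m).indicator g with hG
  have hGm : Measurable G := measurable_indicator_of_continuousOn (isOpen_core m) hg.continuousOn
  have hmodeG : ∀ (n k : ℤ), mode n k G = (core m).indicator (mode n k g) := by
    intro n k
    ext w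
    by_cases hw : w ∈ core m
    · rw [Set.indicator_of_mem hw, mode, mode]
      simp only [hG, Set.indicator_of_mem (hinv _ w hw)]
    · rw [Set.indicator_of_notMem hw, mode]
      have : ∀ x, G (rot x w) = 0 := fun x =>
        Set.indicator_of_notMem (fun h => hw ((hinv.rot_mem_iff x w).1 h)) _
      simp [this]
  refine eq_zero_of_mode_eq_zero hinv hg.continuousOn hz fun n k => ?_
  rw [mode_eq_coeff_mul n k g hz1 hz2, coeff_eq hg n k hz hz1 hz2]
  set c := coeff n k g (((1 : ℝ) : ℂ), ((1 : ℝ) : ℂ)) with hc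
  suffices h : c = 0 by rw [h, zero_mul]
  by_cases hneg : n < 0 ∨ k < 0
  · exact coeff_eq_zero_of_neg hg n k hneg
  push Not at hneg
  obtain ⟨a, rfl⟩ := Int.eq_ofNat_of_zero_le hneg.1
  obtain ⟨b, rfl⟩ := Int.eq_ofNat_of_zero_le hneg.2
  have hmode : ∀ᵐ w ∂volume.restrict (core m), mode a b g w = c * monom a b w := by
    filter_upwards [ae_restrict_mem hms, ae_restrict_of_ae ae_ne_zero] with w hw hw0
    rw [mode_eq_coeff_mul _ _ g hw0.1 hw0.2, coeff_eq hg _ _ hw hw0.1 hw0.2, ← hc, zpow_natCast,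
      zpow_natCast, monom]
  by_contra hc0
  have hsq : ∀ F : ℂ × ℂ → ℂ, ∫⁻ z, ‖(core m).indicator F z‖ₑ ^ 2 =
      ∫⁻ z in core m, ‖F z‖ₑ ^ 2 := by
    intro F
    rw [← lintegral_indicator hms]
    refine lintegral_congr fun w => ?_
    by_cases hw : w ∈ core m <;> simp [hw]
  -- A nonzero coefficient forces the monomial into `L²`, because the mode is no larger in norm than
  -- `g`. Orthogonality to this monomial can then be used.
  have hR : (a, b) ∈ R m := by
    rw [← lintegral_core_lt_top_iff hm]
    have h1 := lintegral_mode_sq_le a b hGm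
    rw [hmodeG, hG, hsq, hsq] at h1
    have h2 := h1.trans_lt ((memLp_two_iff hL.1).1 hL)
    have h3 : ∫⁻ w in core m, ‖mode a b g w‖ₑ ^ 2 =
        ‖c‖ₑ ^ 2 * ∫⁻ w in core m, ‖monom a b w‖ₑ ^ 2 := by
      rw [← lintegral_const_mul' _ _ (ENNReal.pow_ne_top enorm_ne_top)]
      refine lintegral_congr_ae ?_
      filter_upwards [hmode] with w hw
      rw [hw, enorm_mul, mul_pow]
    rw [h3] at h2
    rcases ENNReal.mul_lt_top_iff.1 h2 with h4 | h4 | h4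
    · exact h4.2
    · simp [hc0] at h4
    · rw [h4]; simp
  have hind : ∀ F : ℂ × ℂ → ℂ, ∫ w, conj (monom a b w) * (core m).indicator F w =
      ∫ w in core m, conj (monom a b w) * F w := by
    intro F
    rw [← integral_indicator hms]
    refine integral_congr_ae (ae_of_all _ fun w => ?_)
    by_cases hw : w ∈ core m <;> simp [hw]
  have hi : Integrable fun w => conj (monom a b w) * G w := by
    have h1 : IntegrableOn (fun w => conj (monom a b w) * g w) (core m) :=
      ((memLp_monom_iff hm a b).2 hR).star.integrable_mul hL
    refine ((integrable_indicator_iff hms).2 h1).congr (ae_of_all _ fun w => ?_)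
    by_cases hw : w ∈ core m <;> simp [hG, hw]
  have key := integral_conj_monom_mul_mode a b hi
  rw [hmodeG, hG, hind, hind, horth a b hR] at key
  have h5 : ∫ w in core m, conj (monom a b w) * mode a b g w =
      c * ((∫ w in core m, ‖monom a b w‖ ^ 2 : ℝ) : ℂ) := by
    rw [← integral_complex_ofReal, ← integral_const_mul]
    refine integral_congr_ae ?_
    filter_upwards [hmode] with w hw
    rw [hw, mul_left_comm, RCLike.conj_mul]
    simp
  rw [h5] at key
  have hpos := integral_norm_monom_sq_pos hm hR
  rcases mul_eq_zero.1 key with h | h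
  · exact hc0 h
  · exact hpos.ne' (by exact_mod_cast h)

/-! ### Matrix coefficients of the Toeplitz operator -/

theorem inner_eq_setIntegral {m : ℕ} (hm : 1 ≤ m)
    {u v : Lp ℂ 2 (volume.restrict (Omega m : Set (ℂ × ℂ)))} {g h : ℂ × ℂ → ℂ}
    (hu : u =ᵐ[volume.restrict (Omega m : Set (ℂ × ℂ))] g)
    (hv : v =ᵐ[volume.restrict (Omega m : Set (ℂ × ℂ))] h) :
    inner ℂ u v = ∫ z in core m, conj (g z) * h z := by
  rw [L2.inner_def, ← restrict_Omega hm]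
  refine integral_congr_ae ?_
  filter_upwards [hu, hv] with z h1 h2
  rw [h1, h2, RCLike.inner_apply, mul_comm]

theorem exists_isMono_iff {m : ℕ} (hm : 2 ≤ m) (a b : ℕ) :
    (∃ f, IsMono m f a b) ↔ (a, b) ∈ R m := by
  rw [← memLp_monom_iff hm, ← restrict_Omega (by omega)]
  constructor
  · rintro ⟨f, hf⟩
    exact (memLp_congr_ae hf).1 (Lp.memLp _)
  · intro h
    refine ⟨⟨h.toLp _, monom a b, ?_, h.coeFn_toLp⟩, h.coeFn_toLp⟩
    unfold monom
    fun_prop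

theorem eq_zero_of_inner_eq_zero {m : ℕ} (hm : 2 ≤ m) {f : bergmanSpace (Omega m)}
    (h : ∀ a b e, IsMono m e a b → inner ℂ e f = 0) : f = 0 := by
  have hm1 : 1 ≤ m := by omega
  obtain ⟨g, hg, hfg⟩ := f.2
  have hL : MemLp g 2 (volume.restrict (core m)) := by
    rw [← restrict_Omega hm1]
    exact (memLp_congr_ae hfg).1 (Lp.memLp _)
  have horth : ∀ a b, (a, b) ∈ R m → ∫ z in core m, conj (monom a b z) * g z = 0 := by
    intro a b hab
    obtain ⟨e, he⟩ := (exists_isMono_iff hm a b).2 hab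
    rw [← inner_eq_setIntegral hm1 he hfg]
    exact h a b e he
  have hz : ∀ᵐ z ∂volume.restrict (Omega m : Set (ℂ × ℂ)), g z = 0 := by
    rw [restrict_Omega hm1]
    filter_upwards [ae_restrict_mem (isOpen_core m).measurableSet, ae_restrict_of_ae ae_ne_zero]
      with z h1 h2
    exact eq_zero_of_orthogonal_monom hm (hg.mono (core_subset_Omega hm1)) hL horth h1 h2.1 h2.2
  apply Subtype.ext
  apply Lp.ext
  filter_upwards [hfg, hz, Lp.coeFn_zero ℂ 2 (volume.restrict (Omega m : Set (ℂ × ℂ)))]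
    with z h1 h2 h3
  rw [h1, h2]
  exact h3.symm

/-- The projection disappears when paired with an element of `A²`, so its kernel is never needed. -/
theorem inner_Tphi {m : ℕ} (hm : 1 ≤ m) {e f : bergmanSpace (Omega m)} {g h : ℂ × ℂ → ℂ}
    (he : (e : Lp ℂ 2 (volume.restrict (Omega m : Set (ℂ × ℂ))))
      =ᵐ[volume.restrict (Omega m : Set (ℂ × ℂ))] g)
    (hf : (f : Lp ℂ 2 (volume.restrict (Omega m : Set (ℂ × ℂ))))
      =ᵐ[volume.restrict (Omega m : Set (ℂ × ℂ))] h) :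
    inner ℂ e (Tphi m f) = ∫ z in core m, conj (g z) * (phi z * h z) := by
  have h1 : inner ℂ e (Tphi m f) =
      inner ℂ (e : Lp ℂ 2 (volume.restrict (Omega m : Set (ℂ × ℂ))))
        ((memLp_phi (volume.restrict (Omega m : Set (ℂ × ℂ)))).toLp phi •
          (f : Lp ℂ 2 (volume.restrict (Omega m : Set (ℂ × ℂ)))) :) :=
    Submodule.inner_orthogonalProjectionOnto_eq_of_mem_left e _
  rw [h1]
  refine inner_eq_setIntegral hm he ?_
  filter_upwards [Lp.coeFn_lpSMul (r := 2)
    ((memLp_phi (volume.restrict (Omega m : Set (ℂ × ℂ)))).toLp phi)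
    (f : Lp ℂ 2 (volume.restrict (Omega m : Set (ℂ × ℂ)))),
    (memLp_phi (volume.restrict (Omega m : Set (ℂ × ℂ)))).coeFn_toLp, hf] with z h2 h3 h4
  rw [h2, Pi.smul_apply', h3, h4, smul_eq_mul]

theorem chi_mul_chi (n k n' k' : ℤ) (x : Torus) :
    chi n k x * chi n' k' x = chi (n + n') (k + k') x := by
  simp only [chi, fourier_add]; ring

theorem phi_rot (x : Torus) (z : ℂ × ℂ) : phi (rot x z) = chi 2 0 x * phi z := by
  have h1 : conj (fourier 1 x.1) = (fourier 1 x.1)⁻¹ := by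
    rw [← fourier_neg, fourier_eq_zpow, zpow_neg, zpow_one]
  have h2 := fourier_one_ne_zero x.1
  simp only [phi, rot, chi, map_mul, h1, fourier_zero, mul_one]
  rw [fourier_eq_zpow 2]
  by_cases hz : z.1 = 0
  · simp [hz]
  · have : conj z.1 ≠ 0 := by simpa using hz
    field_simp

theorem cSq_eq {m : ℕ} (hm : 1 ≤ m) (a b : ℕ) :
    cSq m a b = ∫ z in core m, ‖monom a b z‖ ^ 2 := by
  rw [cSq, restrict_Omega hm]

theorem cSq_pos {m : ℕ} (hm : 2 ≤ m) {a b : ℕ} (h : (a, b) ∈ R m) : 0 < cSq m a b := by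
  rw [cSq_eq (by omega)]; exact integral_norm_monom_sq_pos hm h

theorem inner_isMono_self {m : ℕ} (hm : 1 ≤ m) {a b : ℕ} {e g : bergmanSpace (Omega m)}
    (he : IsMono m e a b) (hg : IsMono m g a b) : inner ℂ e g = (cSq m a b : ℂ) := by
  rw [Submodule.coe_inner, inner_eq_setIntegral hm he hg, cSq_eq hm, ← integral_complex_ofReal]
  refine integral_congr_ae (ae_of_all _ fun z => ?_)
  simp [RCLike.conj_mul]

theorem inner_isMono_of_ne {m : ℕ} (hm : 1 ≤ m) {a b c d : ℕ} {e g : bergmanSpace (Omega m)}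
    (he : IsMono m e c d) (hg : IsMono m g a b) (h : (c, d) ≠ (a, b)) : inner ℂ e g = 0 := by
  rw [Submodule.coe_inner, inner_eq_setIntegral hm he hg]
  refine (torusInvariant_core m).setIntegral_eq_zero (n := -c + a) (k := -d + b) ?_ fun x z => ?_
  · by_contra hcon
    push Not at hcon
    exact h (Prod.ext (by simp only; omega) (by simp only; omega))
  · rw [monom_rot, monom_rot, map_mul, conj_chi, ← chi_mul_chi]
    ring

/-- The symbol moves one factor from `conj z₁` to `z₁`, leaving `|z₁| ^ (2 * (a + 1))`; hence the
index `a + 1`. -/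
theorem inner_Tphi_isMono {m : ℕ} (hm : 1 ≤ m) {a b : ℕ} {e f : bergmanSpace (Omega m)}
    (he : IsMono m e (a + 2) b) (hf : IsMono m f a b) :
    inner ℂ e (Tphi m f) = (cSq m (a + 1) b : ℂ) := by
  rw [inner_Tphi hm he hf, cSq_eq hm, ← integral_complex_ofReal]
  refine integral_congr_ae (ae_of_all _ fun z => ?_)
  have h1 : ((‖monom (a + 1) b z‖ ^ 2 : ℝ) : ℂ) =
      conj (monom (a + 1) b z) * monom (a + 1) b z := by
    simp [RCLike.conj_mul]
  refine Eq.trans ?_ h1.symm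
  simp only [monom, phi, map_mul, map_pow]
  by_cases hz : z.1 = 0
  · simp [hz]
  · have : conj z.1 ≠ 0 := by simpa using hz
    field_simp
    ring

theorem inner_Tphi_isMono_of_ne {m : ℕ} (hm : 1 ≤ m) {a b c d : ℕ} {e f : bergmanSpace (Omega m)}
    (he : IsMono m e c d) (hf : IsMono m f a b) (h : (c, d) ≠ (a + 2, b)) :
    inner ℂ e (Tphi m f) = 0 := by
  rw [inner_Tphi hm he hf]
  refine (torusInvariant_core m).setIntegral_eq_zero (n := -c + (2 + a)) (k := -d + (0 + b)) ?_
    fun x z => ?_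
  · by_contra hcon
    push Not at hcon
    exact h (Prod.ext (by simp only; omega) (by simp only; omega))
  · rw [monom_rot, monom_rot, phi_rot, map_mul, conj_chi, ← chi_mul_chi, ← chi_mul_chi]
    ring

/-- Both sides have the same inner product with every monomial in `A²`; only the monomial of
exponent `(a + 2, b)` gives a nonzero value. -/
theorem Tphi_isMono {m : ℕ} (hm : 2 ≤ m) {a b : ℕ} {f g : bergmanSpace (Omega m)}
    (hf : IsMono m f a b) (hg : IsMono m g (a + 2) b) :
    Tphi m f = ((cSq m (a + 1) b / cSq m (a + 2) b : ℝ) : ℂ) • g := by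
  have hm1 : 1 ≤ m := by omega
  have hpos := cSq_pos hm ((exists_isMono_iff hm _ _).1 ⟨g, hg⟩)
  rw [← sub_eq_zero]
  refine eq_zero_of_inner_eq_zero hm fun c d e he => ?_
  have hsmul : ∀ r : ℂ, inner ℂ e (r • g) = r * inner ℂ e g := fun r => inner_smul_right e g r
  rw [inner_sub_right, hsmul]
  by_cases h : (c, d) = (a + 2, b)
  · obtain ⟨rfl, rfl⟩ := Prod.mk.inj h
    rw [inner_Tphi_isMono hm1 he hf, inner_isMono_self hm1 he hg]
    have : (cSq m (a + 2) d : ℂ) ≠ 0 := by exact_mod_cast hpos.ne'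
    push_cast
    field_simp
    simp
  · rw [inner_Tphi_isMono_of_ne hm1 he hf h, inner_isMono_of_ne hm1 he hg h, mul_zero, sub_zero]

theorem Tphi_isMono_eq_zero {m : ℕ} (hm : 2 ≤ m) {a b : ℕ} {f : bergmanSpace (Omega m)}
    (hf : IsMono m f a b) (h : (a + 2, b) ∉ R m) : Tphi m f = 0 := by
  refine eq_zero_of_inner_eq_zero hm fun c d e he => ?_
  refine inner_Tphi_isMono_of_ne (by omega) he hf fun hcd => h ?_
  rw [← hcd]
  exact (exists_isMono_iff hm _ _).1 ⟨e, he⟩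

theorem norm_Tphi_le (m : ℕ) (f : bergmanSpace (Omega m)) :
    ‖Tphi m f‖ ≤
      ‖(memLp_phi (volume.restrict (Omega m : Set (ℂ × ℂ)))).toLp phi‖ * ‖f‖ :=
  ((bergmanSpace (Omega m)).norm_orthogonalProjectionOnto_apply_le _).trans
    (Lp.norm_smul_le _ _)

/-! ### Powers, nilpotency and rank -/

theorem mem_R_of_le {m a b c d : ℕ} (h1 : (a, b) ∈ R m) (h2 : (c, b) ∈ R m) (hd : a ≤ d)
    (hd' : d ≤ c) : (d, b) ∈ R m :=
  ⟨hd'.trans h2.1, h1.2.trans_le (by exact_mod_cast hd)⟩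

/-- Slices of `R m` are intervals, so every intermediate exponent lies in `R m` and all the weights
of the shift are positive. -/
theorem Tphi_pow_isMono {m : ℕ} (hm : 2 ≤ m) {a b : ℕ} {f : bergmanSpace (Omega m)}
    (hf : IsMono m f a b) (k : ℕ) {g : bergmanSpace (Omega m)} (hg : IsMono m g (a + 2 * k) b) :
    ∃ c : ℂ, c ≠ 0 ∧ (Tphi m ^ k) f = c • g := by
  have hfR := (exists_isMono_iff hm _ _).1 ⟨f, hf⟩
  induction k generalizing g with
  | zero =>
    refine ⟨1, one_ne_zero, ?_⟩
    rw [pow_zero, one_smul, Module.End.one_apply]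
    exact Subtype.ext (Lp.ext (hf.trans hg.symm))
  | succ k ih =>
    have hgR := (exists_isMono_iff hm _ _).1 ⟨g, hg⟩
    have hR : ∀ j, j ≤ 2 * k + 2 → (a + j, b) ∈ R m := fun j hj =>
      mem_R_of_le hfR hgR (by omega) (by omega)
    obtain ⟨g', hg'⟩ := (exists_isMono_iff hm _ _).2 (hR (2 * k) (by omega))
    obtain ⟨c, hc, hcg⟩ := ih hg'
    have h1 := cSq_pos hm (hR (2 * k + 1) (by omega))
    have h2 := cSq_pos hm (hR (2 * k + 2) (by omega))
    refine ⟨c * ((cSq m (a + (2 * k + 1)) b / cSq m (a + (2 * k + 2)) b : ℝ) : ℂ),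
      mul_ne_zero hc (by exact_mod_cast (div_pos h1 h2).ne'), ?_⟩
    rw [pow_succ', Module.End.mul_apply, hcg, map_smul, mul_smul]
    congr 1
    exact Tphi_isMono hm hg' hg

theorem Tphi_pow_isMono_eq_zero {m : ℕ} (hm : 2 ≤ m) {a b : ℕ} {f : bergmanSpace (Omega m)}
    (hf : IsMono m f a b) (k : ℕ) (h : (a + 2 * k, b) ∉ R m) : (Tphi m ^ k) f = 0 := by
  induction k with
  | zero => exact absurd ((exists_isMono_iff hm _ _).1 ⟨f, hf⟩) h
  | succ k ih =>
    rw [pow_succ', Module.End.mul_apply]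
    by_cases h' : (a + 2 * k, b) ∈ R m
    · obtain ⟨g, hg⟩ := (exists_isMono_iff hm _ _).2 h'
      obtain ⟨c, -, hcg⟩ := Tphi_pow_isMono hm hf k hg
      rw [hcg, map_smul, Tphi_isMono_eq_zero hm hg h, smul_zero]
    · rw [ih h', map_zero]

theorem continuous_Tphi_pow (m k : ℕ) : Continuous (Tphi m ^ k : _ →ₗ[ℂ] _) := by
  have h1 : Continuous (Tphi m) :=
    AddMonoidHomClass.continuous_of_bound (Tphi m) _ (norm_Tphi_le m)
  induction k with
  | zero => exact continuous_id
  | succ k ih =>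
    rw [pow_succ']
    exact h1.comp ih

/-- The span of the monomials has trivial orthogonal complement, hence is dense; the kernel of `S`
is closed and contains it. -/
theorem eq_zero_of_isMono {m : ℕ} (hm : 2 ≤ m)
    {S : bergmanSpace (Omega m) →ₗ[ℂ] bergmanSpace (Omega m)} (hS : Continuous S)
    (h : ∀ a b f, IsMono m f a b → S f = 0) : S = 0 := by
  set K : Submodule ℂ (bergmanSpace (Omega m)) := Submodule.span ℂ {f | ∃ a b, IsMono m f a b}
  have hK : K.topologicalClosure = ⊤ := by
    rw [Submodule.topologicalClosure_eq_top_iff, Submodule.eq_bot_iff]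
    intro f hf
    refine eq_zero_of_inner_eq_zero hm fun a b e he => ?_
    exact (Submodule.mem_orthogonal K f).1 hf e (Submodule.subset_span ⟨a, b, he⟩)
  have hle : K ≤ LinearMap.ker S := by
    refine Submodule.span_le.2 ?_
    rintro f ⟨a, b, hf⟩
    exact h a b f hf
  have hcl : IsClosed (LinearMap.ker S : Set (bergmanSpace (Omega m))) :=
    isClosed_singleton.preimage hS
  have htop := Submodule.topologicalClosure_minimal K hle hcl
  rw [hK, top_le_iff] at htop
  exact LinearMap.ker_eq_top.1 htop

theorem Tphi_pow_eq_zero {m : ℕ} (hm : 2 ≤ m) : Tphi m ^ ((m + 2) / 4) = 0 := by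
  refine eq_zero_of_isMono hm (continuous_Tphi_pow m _) fun a b f hf => ?_
  refine Tphi_pow_isMono_eq_zero hm hf _ fun hR => ?_
  obtain ⟨-, h1⟩ := (exists_isMono_iff hm _ _).1 ⟨f, hf⟩
  have h2 : a + 2 * ((m + 2) / 4) ≤ b := hR.1
  simp only at h1
  -- With `N = (m + 2) / 4`, this and `a + 2N ≤ b` give `4N + 1 < m`, whereas the floor satisfies
  -- `4N ≥ m - 1`.
  have h3 : 2 * b + 1 < 2 * a + m := by
    have : (2 * b + 1 : ℝ) < 2 * a + m := by linarith
    exact_mod_cast this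
  omega

/-- Starting points of chains of `k` steps that end on the diagonal. -/
theorem mem_R_sub {m k b : ℕ} (hk : k < (m + 2) / 4) (hb : 2 * k ≤ b) : (b - 2 * k, b) ∈ R m := by
  refine ⟨Nat.sub_le _ _, ?_⟩
  have h1 : 4 * k + 1 < m := by omega
  have h2 : (4 * k + 1 : ℝ) < m := by exact_mod_cast h1
  push_cast [Nat.cast_sub hb]
  linarith

theorem mem_R_diag {m : ℕ} (hm : 2 ≤ m) (b : ℕ) : (b, b) ∈ R m :=
  mem_R_sub (k := 0) (by omega) (by omega)

theorem isMono_ne_zero {m : ℕ} (hm : 2 ≤ m) {a b : ℕ} {f : bergmanSpace (Omega m)}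
    (hf : IsMono m f a b) : f ≠ 0 := by
  rintro rfl
  have h1 := inner_isMono_self (by omega) hf hf
  have h2 := cSq_pos hm ((exists_isMono_iff hm _ _).1 ⟨_, hf⟩)
  rw [inner_zero_left] at h1
  exact h2.ne (by exact_mod_cast h1)

theorem Tphi_pow_ne_zero {m k : ℕ} (hm : 2 ≤ m) (hk : k < (m + 2) / 4) : Tphi m ^ k ≠ 0 := by
  intro h
  obtain ⟨f, hf⟩ := (exists_isMono_iff hm _ _).2 (mem_R_sub hk le_rfl)
  obtain ⟨g, hg⟩ := (exists_isMono_iff hm _ _).2 (mem_R_diag hm (2 * k))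
  obtain ⟨c, hc, hcg⟩ := Tphi_pow_isMono hm hf k (g := g) (by simpa using hg)
  rw [h, LinearMap.zero_apply] at hcg
  exact smul_ne_zero hc (isMono_ne_zero hm hg) hcg.symm

/-- The diagonal monomials of exponent `(b + 2, b + 2)` are pairwise orthogonal and lie in the
range, as images of multiples of those of exponent `(b, b + 2)`; `m ≥ 6` is what puts the latter in
`R m`. -/
theorem not_finiteDimensional_range_Tphi {m : ℕ} (hm : 6 ≤ m) :
    ¬ FiniteDimensional ℂ (LinearMap.range (Tphi m)) := by
  intro hfin
  have hm2 : 2 ≤ m := by omega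
  choose g hg using fun b : ℕ => (exists_isMono_iff hm2 _ _).2 (mem_R_diag hm2 (b + 2))
  have hrange : ∀ b, g b ∈ LinearMap.range (Tphi m) := by
    intro b
    obtain ⟨f, hf⟩ := (exists_isMono_iff hm2 _ _).2
      (mem_R_sub (m := m) (k := 1) (b := b + 2) (by omega) (by omega))
    obtain ⟨c, hc, hcg⟩ := Tphi_pow_isMono hm2 hf 1 (g := g b) (by simpa using hg b)
    rw [pow_one] at hcg
    exact ⟨c⁻¹ • f, by rw [map_smul, hcg, smul_smul, inv_mul_cancel₀ hc, one_smul]⟩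
  have hli : LinearIndependent ℂ g := by
    refine linearIndependent_of_ne_zero_of_inner_eq_zero (fun b => isMono_ne_zero hm2 (hg b)) ?_
    intro b b' hbb
    refine inner_isMono_of_ne (by omega) (hg b) (hg b') fun h => hbb ?_
    have := (Prod.mk.inj h).1
    omega
  have hli' : LinearIndependent ℂ fun b => (⟨g b, hrange b⟩ : LinearMap.range (Tphi m)) :=
    LinearIndependent.of_comp (LinearMap.range (Tphi m)).subtype hli
  exact not_finite_iff_infinite.2 inferInstance hli'.finite

end Reinhardt

end

theorem mainTheorem2 (m : ℕ) (hm : 6 ≤ m) :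
    -- `T_φ` is not the zero operator
    Reinhardt.Tphi m ≠ 0 ∧
    -- `T_φ` does not have finite rank
    ¬ FiniteDimensional ℂ (LinearMap.range (Reinhardt.Tphi m)) ∧
    -- `T_φ` is bounded
    (∃ C : ℝ, ∀ f : bergmanSpace (Reinhardt.Omega m), ‖Reinhardt.Tphi m f‖ ≤ C * ‖f‖) ∧
    -- `T_φ` is nilpotent of degree `⌊(m + 2) / 4⌋`
    (Reinhardt.Tphi m ^ ((m + 2) / 4) = 0 ∧
      ∀ k : ℕ, k < (m + 2) / 4 → Reinhardt.Tphi m ^ k ≠ 0) ∧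
    -- the monomials in `A²(Ω_m)` are those with exponents in `R_m`
    (∀ a b : ℕ, (∃ f, Reinhardt.IsMono m f a b) ↔ (a, b) ∈ Reinhardt.R m) ∧
    -- `T_φ` acts on them as a weighted shift
    (∀ a b : ℕ, ∀ f g : bergmanSpace (Reinhardt.Omega m),
      Reinhardt.IsMono m f a b → Reinhardt.IsMono m g (a + 2) b →
        Reinhardt.Tphi m f =
          ((Reinhardt.cSq m (a + 1) b / Reinhardt.cSq m (a + 2) b : ℝ) : ℂ) • g) ∧
    (∀ a b : ℕ, ∀ f : bergmanSpace (Reinhardt.Omega m),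
      Reinhardt.IsMono m f a b → (a + 2, b) ∉ Reinhardt.R m → Reinhardt.Tphi m f = 0) := by
  have hm2 : 2 ≤ m := by omega
  refine ⟨?_, Reinhardt.not_finiteDimensional_range_Tphi hm, ⟨_, Reinhardt.norm_Tphi_le m⟩,
    ⟨Reinhardt.Tphi_pow_eq_zero hm2, fun k hk => Reinhardt.Tphi_pow_ne_zero hm2 hk⟩,
    Reinhardt.exists_isMono_iff hm2, fun a b f g => Reinhardt.Tphi_isMono hm2,
    fun a b f => Reinhardt.Tphi_isMono_eq_zero hm2⟩
  simpa using Reinhardt.Tphi_pow_ne_zero (k := 1) hm2 (by omega)
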